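/- **Theorem 2 (Quenched central limit theorem).** *Setting.* Let $\mathbb R_+=[0,\infty)$ and $\mathbb N=\{1,2,\dots\}$. Let $f:\mathbb R_+^2\to[0,1]$ be measurable with $f(x,y)+f(y,x)=1$ for all $x,y$. Let $\mu,\nu$ be Borel probability measures on $\mathbb R_+$, and let $\xi=(\xi_\ell)_{\ell\in\mathbb N}$ be an $\mathbb R_+$-valued process such that $\xi_\ell\sim\nu$ for all $\ell$ and $(\xi_\ell,\xi_k)\overset{d}{=}(\xi_{\ell+\tau},\xi_{k+\tau})$ for all $\ell,k,\tau\in\mathbb N$. Assume: * (weak mixing) for every $A\in\sigma(\xi_1)$ and all $B_\ell\in\sigma(\xi_\ell)$, $\ell\in\mathbb N$, one has $\frac1n\sum_{\ell=1}^n|\mathbb P(A\cap B_\ell)-\mathbb P(A)\mathbb P(B_\ell)|\to0$ as $n\to\infty$; * (strong mixing) with $$\alpha_n=\sup\bigl\{|\mathbb P(A\cap B)-\mathbb P(A)\mathbb P(B)| : k\in\mathbb N,\ A\in\sigma(\xi_1,\dots,\xi_k),\ B\in\sigma(\xi_{k+n},\xi_{k+n+1},\dots)\bigr\},$$ one has $\sum_{n\ge1}\alpha_n<\infty$,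 and there are integer sequences $p=p(n)\to\infty$, $q=q(n)\to\infty$ with $q=o(p)$, $p=o(n)$, $np^{-1}\alpha_q\to0$ and $\frac pn\sum_{j=1}^p j\alpha_j\to0$. *The league.* For each $n$ consider a league of $2n$ teams $T_0,\dots,T_{2n-1}$ with a fixed calendar of $2n-1$ days, in which each team plays exactly one match per day and exactly one match against each other team. Given $s\in\mathbb R_+$ and a deterministic sequence $\vec s=(s_i)_{i\in\mathbb N}\in\mathbb R_+^{\mathbb N}$, let $T_0$ have initial strength $s_0=s$ and $T_i$ initial strength $s_i$ for $1\le i\le 2n-1$. Let $\xi^0,\dots,\xi^{2n-1}$ be independent copies of $\xi$; the strength of $T_i$ on day $d$ is $s_i\,\xi^i_d$. Conditionally on $(\xi^i)_i$, the results of the matches are independent, and if $T_i$ plays $T_j$ on day $d$, then $T_i$ wins with probability $f(s_i\xi^i_d,s_j\xi^j_d)$ (otherwise $T_j$ wins). Let $\mathbb P_{\vec s}$, $\mathbb E_{\vec s}$ denote the resulting probability and expectation, and $W_n(s)$ the number of wins of $T_0$. *Constants.* Let $V,V'\sim\nu$ and $U,U'\sim\mu$ be independent of each other and of $\xi$, and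 put $\ell(s)=\mathbb E[f(sV,UV')]$, $F_s(x,y)=\mathbb E[f(sx,yV')]$, $\tilde F_s(x,y)=F_s(x,y)-\mathbb E[F_s(V,y)]$, $$\sigma(s)^2=\mathbb E\bigl[F_s(V,U)-F_s(V,U)^2\bigr],\qquad \rho(s)^2=\mathbb E\bigl[\tilde F_s(V,U)^2\bigr]+2\sum_{k=1}^\infty\mathbb E\bigl[\tilde F_s(\xi_1,U)\,\tilde F_s(\xi_{1+k},U')\bigr].$$ *Claim.* Fix the calendars and any $s\in\mathbb R_+$. Then $\sigma(s)^2=\ell(s)-\mathbb E[F_s(V,U)^2]$, the series defining $\rho(s)^2$ converges (absolutely), $\sigma(s)^2$ and $\rho(s)^2$ are nonnegative, and for $\mu^{\mathbb N}$-almost every $\vec s$, under $\mathbb P_{\vec s}$, $$\frac{W_n(s)-\mathbb E_{\vec s}[W_n(s)]}{\sqrt{2n}}\xrightarrow[n\to\infty]{d}\mathcal N\bigl(0,\sigma(s)^2+\rho(s)^2\bigr).$$ -/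

import Mathlib

open MeasureTheory ProbabilityTheory Filter Topology Asymptotics
open scoped NNReal unitInterval

noncomputable section

namespace League

/-! Times (days) and opponents are numbered from `0` instead of `1`: `ξ ℓ` is the value of the
process on day number `ℓ + 1`, and `S j` is the initial strength of the team `T_{j+1}`. -/

/-- The function `f : ℝ₊² → [0,1]`: a team of strength `x` beats a team of strength `y` with
probability `f x y`. Draws are impossible. -/
structure WinFunction where
  toFun : ℝ≥0 → ℝ≥0 → I
  measurable : Measurable (Function.uncurry toFun)
  no_draw : ∀ x y, (toFun x y : ℝ) + (toFun y x : ℝ) = 1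

instance : CoeFun WinFunction (fun _ => ℝ≥0 → ℝ≥0 → I) := ⟨WinFunction.toFun⟩

/-- A calendar for a league of `N + 1` teams `T_0, …, T_N` and `N` days: `day i j` is the day of
the match between `T_i` and `T_j` (the value for `i = j` is irrelevant). Every team plays exactly
one match on each of the `N` days, one against each other team. -/
structure Calendar (N : ℕ) where
  day : Fin (N + 1) → Fin (N + 1) → ℕ
  symm : ∀ i j, day i j = day j i
  bijOn : ∀ i, Set.BijOn (day i) {i}ᶜ (Set.Iio N)

/-- The matches of a league of `N + 1` teams: the pairs of teams, listed as `(i, j)`, `i < j`. -/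
abbrev Match (N : ℕ) : Type := {m : Fin (N + 1) × Fin (N + 1) // m.1 < m.2}

/-- The probability that the first team of the match `m` wins, when the initial strengths are `x`
and `e i` is the path of the process of the team `T_i`. -/
def winProb (f : WinFunction) {N : ℕ} (C : Calendar N) (x : Fin (N + 1) → ℝ≥0)
    (e : Fin (N + 1) → ℕ → ℝ≥0) (m : Match N) : I :=
  f (x m.1.1 * e m.1.1 (C.day m.1.1 m.1.2)) (x m.1.2 * e m.1.2 (C.day m.1.1 m.1.2))

/-- The conditional law of the results of all matches given the paths of the processes: the
results are independent, and the first team of `m` wins (`true`) with probability `winProb`. -/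
def condResults (f : WinFunction) {N : ℕ} (C : Calendar N) (x : Fin (N + 1) → ℝ≥0)
    (e : Fin (N + 1) → ℕ → ℝ≥0) : Measure (Match N → Bool) :=
  Measure.pi fun m => bernoulliMeasure true false (winProb f C x e m)

lemma measurable_condResults (f : WinFunction) {N : ℕ} (C : Calendar N)
    (x : Fin (N + 1) → ℝ≥0) : Measurable (condResults f C x) := by
  have hw : ∀ m : Match N, Measurable fun e => winProb f C x e m := by
    intro m
    have h : Measurable fun e : Fin (N + 1) → ℕ → ℝ≥0 =>
        (x m.1.1 * e m.1.1 (C.day m.1.1 m.1.2), x m.1.2 * e m.1.2 (C.day m.1.1 m.1.2)) := by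
      fun_prop
    exact f.measurable.comp h
  refine Measure.measurable_of_measurable_coe _ fun A _ => ?_
  have hA : ∀ e, condResults f C x e A = ∑ r ∈ A.toFinite.toFinset, condResults f C x e {r} := by
    intro e
    rw [sum_measure_singleton]
    simp
  simp_rw [hA, condResults, Measure.pi_singleton]
  refine Finset.measurable_sum _ fun r _ => Finset.measurable_prod _ fun m _ => ?_
  have hm := hw m
  have hs : Measurable fun e => unitInterval.toNNReal (winProb f C x e m) :=
    unitInterval.toNNReal_continuous.measurable.comp hm
  have hs' : Measurable fun e => unitInterval.toNNReal (σ (winProb f C x e m)) :=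
    unitInterval.toNNReal_continuous.measurable.comp
      (unitInterval.continuous_symm.measurable.comp hm)
  simp only [bernoulliMeasure_def, Measure.coe_add, Pi.add_apply, Measure.smul_apply]
  exact (hs.smul_const _).add (hs'.smul_const _)

/-- The law of the results of all matches of a league with deterministic initial strengths `x`,
when the processes of the teams are independent, each with path law `Q`. -/
def resultsLaw (f : WinFunction) (Q : ProbabilityMeasure (ℕ → ℝ≥0)) {N : ℕ} (C : Calendar N)
    (x : Fin (N + 1) → ℝ≥0) : ProbabilityMeasure (Match N → Bool) :=
  ⟨(Measure.pi fun _ : Fin (N + 1) => (Q : Measure (ℕ → ℝ≥0))).bind (condResults f C x),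
    isProbabilityMeasure_bind (measurable_condResults f C x).aemeasurable
      (Eventually.of_forall fun e => by unfold condResults; infer_instance)⟩

/-- The initial strengths of all teams: `s` for `T_0`, and `S 0, S 1, …` for `T_1, T_2, …`. -/
def strengths (s : ℝ≥0) (S : ℕ → ℝ≥0) (N : ℕ) : Fin (N + 1) → ℝ≥0 :=
  Fin.cons s fun j : Fin N => S j

/-- The quenched law `P_{S}` of the results of all matches: the initial strengths are `s` for `T_0`
and the deterministic sequence `S` for its opponents. -/
def quenchedLaw (f : WinFunction) (Q : ProbabilityMeasure (ℕ → ℝ≥0)) {N : ℕ} (C : Calendar N)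
    (s : ℝ≥0) (S : ℕ → ℝ≥0) : Measure (Match N → Bool) :=
  resultsLaw f Q C (strengths s S N)

instance (f : WinFunction) (Q : ProbabilityMeasure (ℕ → ℝ≥0)) {N : ℕ} (C : Calendar N)
    (s : ℝ≥0) (S : ℕ → ℝ≥0) : IsProbabilityMeasure (quenchedLaw f Q C s S) := by
  unfold quenchedLaw; infer_instance

/-- The number of wins of the team `T_0`. -/
def wins {N : ℕ} (r : Match N → Bool) : ℕ :=
  (Finset.univ.filter fun j : Fin N => r ⟨(0, j.succ), j.succ_pos⟩ = true).card

/-- The centred and rescaled number of wins `(W_n(s) - E[W_n(s)]) / √(2n)` of `T_0` in a league of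
`2n` teams, where `L` is the law of the results. -/
def normalizedWins (n : ℕ) (L : Measure (Match (2 * n - 1) → Bool)) (r : Match (2 * n - 1) → Bool) :
    ℝ :=
  ((wins r : ℝ) - ∫ r', (wins r' : ℝ) ∂L) / √(2 * (n : ℝ))

/-! ### The process of daily factors -/

section DailyFactors

variable {Ω : Type*} [MeasurableSpace Ω]

/-- The law of the path of the process `ξ`. -/
def pathLaw (P : Measure Ω) [IsProbabilityMeasure P] (ξ : ℕ → Ω → ℝ≥0)
    (hξ : ∀ ℓ, Measurable (ξ ℓ)) : ProbabilityMeasure (ℕ → ℝ≥0) :=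
  ⟨P.map fun ω ℓ => ξ ℓ ω,
    Measure.isProbabilityMeasure_map (measurable_pi_lambda _ hξ).aemeasurable⟩

/-- The `σ`-algebra generated by the `ξ ℓ`, `ℓ ∈ T`. -/
abbrev sigmaGen (ξ : ℕ → Ω → ℝ≥0) (T : Set ℕ) : MeasurableSpace Ω :=
  ⨆ ℓ ∈ T, MeasurableSpace.comap (ξ ℓ) inferInstance

/-- One-dimensional marginals `ν`, and shift-invariant two-dimensional marginals. -/
structure IsPairStationary (P : Measure Ω) (ξ : ℕ → Ω → ℝ≥0) (ν : Measure ℝ≥0) : Prop where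
  map_eq : ∀ ℓ, P.map (ξ ℓ) = ν
  map_pair_eq : ∀ ℓ k τ, P.map (fun ω => (ξ ℓ ω, ξ k ω)) =
    P.map (fun ω => (ξ (ℓ + τ) ω, ξ (k + τ) ω))

/-- Weak mixing, for sets of `σ(ξ_1)` and `σ(ξ_ℓ)`. -/
def IsWeaklyMixing (P : Measure Ω) (ξ : ℕ → Ω → ℝ≥0) : Prop :=
  ∀ (A : Set Ω) (B : ℕ → Set Ω), MeasurableSet[sigmaGen ξ {0}] A →
    (∀ ℓ, MeasurableSet[sigmaGen ξ {ℓ}] (B ℓ)) →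
    Tendsto (fun n : ℕ => (1 / (n : ℝ)) *
      ∑ ℓ ∈ Finset.range n, |P.real (A ∩ B ℓ) - P.real A * P.real (B ℓ)|) atTop (𝓝 0)

/-- The mixing coefficient `α_n`, for `n ≥ 1` (a supremum of a set of numbers in `[0,1]`). -/
def alpha (P : Measure Ω) (ξ : ℕ → Ω → ℝ≥0) (n : ℕ) : ℝ :=
  sSup {a | ∃ (k : ℕ) (A B : Set Ω), MeasurableSet[sigmaGen ξ (Set.Iic k)] A ∧
    MeasurableSet[sigmaGen ξ (Set.Ici (k + n))] B ∧
    a = |P.real (A ∩ B) - P.real A * P.real B|}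

/-- The mixing assumptions for the central limit theorem. -/
structure CLTMixing (P : Measure Ω) (ξ : ℕ → Ω → ℝ≥0) : Prop where
  summable_alpha : Summable fun n : ℕ => alpha P ξ (n + 1)
  exists_blocks : ∃ p q : ℕ → ℕ, Tendsto p atTop atTop ∧ Tendsto q atTop atTop ∧
    (fun n => (q n : ℝ)) =o[atTop] (fun n => (p n : ℝ)) ∧
    (fun n => (p n : ℝ)) =o[atTop] (fun n => (n : ℝ)) ∧
    Tendsto (fun n : ℕ => (n : ℝ) * (p n : ℝ)⁻¹ * alpha P ξ (q n)) atTop (𝓝 0) ∧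
    Tendsto (fun n : ℕ => (p n : ℝ) / (n : ℝ) *
      ∑ j ∈ Finset.Icc 1 (p n), (j : ℝ) * alpha P ξ j) atTop (𝓝 0)

/-! ### The constants of the limit theorem -/

/-- `ℓ(s) = E[f(s V, U V')]`. -/
def ell (f : WinFunction) (μ ν : Measure ℝ≥0) (s : ℝ≥0) : ℝ :=
  ∫ z, (f (s * z.1) (z.2.2 * z.2.1) : ℝ) ∂(ν.prod (ν.prod μ))

/-- `F_s(x, y) = E[f(s x, y V')]`. -/
def F (f : WinFunction) (ν : Measure ℝ≥0) (s x y : ℝ≥0) : ℝ :=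
  ∫ v, (f (s * x) (y * v) : ℝ) ∂ν

/-- `F̃_s(x, y) = F_s(x, y) - E[F_s(V, y)]`. -/
def Ftilde (f : WinFunction) (ν : Measure ℝ≥0) (s x y : ℝ≥0) : ℝ :=
  F f ν s x y - ∫ v, F f ν s v y ∂ν

/-- `σ(s)² = E[F_s(V, U) - F_s(V, U)²]`. -/
def sigmaSq (f : WinFunction) (μ ν : Measure ℝ≥0) (s : ℝ≥0) : ℝ :=
  ∫ z, (F f ν s z.1 z.2 - F f ν s z.1 z.2 ^ 2) ∂(ν.prod μ)

/-- `E[F̃_s(ξ_1, U) F̃_s(ξ_{1+k}, U')]`, with `ξ`, `U`, `U'` independent. -/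
def covTerm (f : WinFunction) (μ ν : Measure ℝ≥0) (P : Measure Ω) (ξ : ℕ → Ω → ℝ≥0)
    (s : ℝ≥0) (k : ℕ) : ℝ :=
  ∫ z, Ftilde f ν s (ξ 0 z.1) z.2.1 * Ftilde f ν s (ξ k z.1) z.2.2 ∂(P.prod (μ.prod μ))

/-- `ρ(s)² = E[F̃_s(V, U)²] + 2 ∑_{k ≥ 1} E[F̃_s(ξ_1, U) F̃_s(ξ_{1+k}, U')]`. -/
def rhoSq (f : WinFunction) (μ ν : Measure ℝ≥0) (P : Measure Ω) (ξ : ℕ → Ω → ℝ≥0)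
    (s : ℝ≥0) : ℝ :=
  (∫ z, Ftilde f ν s z.1 z.2 ^ 2 ∂(ν.prod μ)) + 2 * ∑' k : ℕ, covTerm f μ ν P ξ s (k + 1)

end DailyFactors

end League

end

/-!
Given the path `ξ` of `T_0`, its results on different days are independent, because they involve
different opponents; integrating out the opponents, `T_0` wins on day `d` with probability
`F_s(ξ_d, y_d)`, where `y_d` is the initial strength of the opponent of that day. So `W_n(s)` has
the law of a number of successes in coin tosses with success probabilities driven by `ξ`. The
centred tosses form a bounded triangular array which is adapted to `σ(ξ_d, u_d)` with independent
uniform `u_d`, hence strongly mixing with the coefficients of `ξ`.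

For such an array the characteristic function `φ_k` at `τ` of the sum `S_k` of the first `k` terms
almost satisfies `φ_{k+1} = (1 - τ² (E[S_{k+1}²] - E[S_k²]) / 2) φ_k`: expand `exp(iτ Z_k)` to
second order and telescope `E[Z_k exp(iτ S_k)]` over times `j < k`. Far interactions are small by
mixing, near ones decouple from `exp(iτ S_j)` up to a short gap. Hence
`φ_k ≈ exp(- τ² E[S_k²] / 2)`, and the array satisfies a central limit theorem as soon as its
normalized variances converge.

The terms of `E[S_n²] / 2n` at distance `k` are averages of a function of the initial strengths of
one opponent (`k = 0`) or of two distinct opponents (`k > 0`). For almost every sequence of initial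
strengths these averages converge to their expectations, by the Hoeffding inequality and the
Borel-Cantelli lemma, and the covariance bound given by mixing justifies the limit under the sum
over `k`.
-/

noncomputable section

namespace League

section MixingCoefficient

variable {Ω : Type*} {𝓐 𝓑 𝓐' 𝓑' mΩ : MeasurableSpace Ω} {P : Measure Ω} {a : ℝ}

/-- The strong mixing coefficient `α(𝓐, 𝓑) = sup |P(A ∩ B) - P(A) P(B)|` of two `σ`-algebras is at
most `a`. -/
def AlphaBound (P : Measure Ω) (𝓐 𝓑 : MeasurableSpace Ω) (a : ℝ) : Prop :=
  ∀ ⦃A B : Set Ω⦄, MeasurableSet[𝓐] A → MeasurableSet[𝓑] B →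
    |P.real (A ∩ B) - P.real A * P.real B| ≤ a

lemma AlphaBound.mono (h : AlphaBound P 𝓐 𝓑 a) (h𝓐 : 𝓐' ≤ 𝓐) (h𝓑 : 𝓑' ≤ 𝓑) :
    AlphaBound P 𝓐' 𝓑' a :=
  fun _ _ hA hB => h (h𝓐 _ hA) (h𝓑 _ hB)

lemma AlphaBound.nonneg (h : AlphaBound P 𝓐 𝓑 a) : 0 ≤ a :=
  (abs_nonneg _).trans (h (@MeasurableSet.empty Ω 𝓐) (@MeasurableSet.empty Ω 𝓑))

variable {E : Type*} [NormedAddCommGroup E] [NormedSpace ℝ E] [CompleteSpace E]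
  {X : Ω → E} {Y : Ω → ℝ} {b c : ℝ}

lemma integral_norm_le_of_abs_setIntegral_le (hYm : StronglyMeasurable[𝓐] Y)
    (hY : Integrable Y P) (hb : ∀ A, MeasurableSet[𝓐] A → |∫ ω in A, Y ω ∂P| ≤ b) :
    ∫ ω, ‖Y ω‖ ∂P ≤ 2 * b := by
  rw [integral_norm_eq_pos_sub_neg hY]
  have hzero : Measurable[𝓐] fun _ : Ω => (0 : ℝ) := measurable_const
  have hpos := (abs_le.1 (hb _ (measurableSet_le hzero hYm.measurable))).2
  have hneg := (abs_le.1 (hb _ (measurableSet_le hYm.measurable hzero))).1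
  linarith

variable [IsProbabilityMeasure P]

lemma integral_smul_sub_eq_integral_condExp_smul (h𝓐 : 𝓐 ≤ mΩ) (hX : StronglyMeasurable[𝓐] X)
    (hXc : ∀ ω, ‖X ω‖ ≤ c) (hY : Integrable Y P) :
    ∫ ω, Y ω • X ω ∂P - P[Y] • P[X] = ∫ ω, P[fun ω => Y ω - P[Y] | 𝓐] ω • X ω ∂P := by
  have hXi : Integrable X P :=
    .of_bound (hX.mono h𝓐).aestronglyMeasurable c (Eventually.of_forall hXc)
  have hsmul : ∀ {Z : Ω → ℝ}, Integrable Z P → Integrable (Z • X) P := fun hZ =>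
    hZ.smul_bdd c (hX.mono h𝓐).aestronglyMeasurable (Eventually.of_forall hXc)
  have hW : Integrable (fun ω => Y ω - P[Y]) P := hY.sub (integrable_const _)
  calc ∫ ω, Y ω • X ω ∂P - P[Y] • P[X] = ∫ ω, ((fun ω => Y ω - P[Y]) • X) ω ∂P := by
        simp only [Pi.smul_apply', sub_smul]
        rw [← integral_smul]
        exact (integral_sub (hsmul hY) (hXi.smul P[Y])).symm
    _ = ∫ ω, (P[(fun ω => Y ω - P[Y]) • X | 𝓐]) ω ∂P := (integral_condExp h𝓐).symm
    _ = _ := integral_congr_ae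
        (condExp_smul_of_aestronglyMeasurable_right hW (hsmul hW) hX.aestronglyMeasurable)

lemma norm_integral_smul_sub_le (h𝓐 : 𝓐 ≤ mΩ) (hX : StronglyMeasurable[𝓐] X)
    (hXc : ∀ ω, ‖X ω‖ ≤ c) (hY : Integrable Y P)
    (hb : ∀ A, MeasurableSet[𝓐] A → |∫ ω in A, Y ω ∂P - P.real A * P[Y]| ≤ b) :
    ‖∫ ω, Y ω • X ω ∂P - P[Y] • P[X]‖ ≤ 2 * b * c := by
  rw [integral_smul_sub_eq_integral_condExp_smul h𝓐 hX hXc hY]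
  set W : Ω → ℝ := fun ω => Y ω - P[Y]
  have hW : Integrable W P := hY.sub (integrable_const _)
  have hset : ∀ A, MeasurableSet[𝓐] A → |∫ ω in A, P[W | 𝓐] ω ∂P| ≤ b := fun A hA => by
    rw [setIntegral_condExp h𝓐 hW hA, integral_sub hY.integrableOn (integrable_const _),
      setIntegral_const, smul_eq_mul]
    exact hb A hA
  have hc : 0 ≤ c := by
    obtain ⟨ω⟩ := nonempty_of_isProbabilityMeasure P
    exact (norm_nonneg _).trans (hXc ω)
  calc ‖∫ ω, P[W | 𝓐] ω • X ω ∂P‖ ≤ ∫ ω, ‖P[W | 𝓐] ω‖ * c ∂P :=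
        norm_integral_le_of_norm_le (integrable_condExp.norm.mul_const c) <| .of_forall fun ω => by
          rw [norm_smul]
          exact mul_le_mul_of_nonneg_left (hXc ω) (norm_nonneg _)
    _ = (∫ ω, ‖P[W | 𝓐] ω‖ ∂P) * c := integral_mul_const _ _
    _ ≤ 2 * b * c := mul_le_mul_of_nonneg_right
        (integral_norm_le_of_abs_setIntegral_le stronglyMeasurable_condExp integrable_condExp hset)
        hc

/- The bound for indicators extends to one function at a time. -/
lemma AlphaBound.norm_integral_smul_sub_le (h : AlphaBound P 𝓐 𝓑 a) (h𝓐 : 𝓐 ≤ mΩ) (h𝓑 : 𝓑 ≤ mΩ)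
    (hX : StronglyMeasurable[𝓐] X) (hXc : ∀ ω, ‖X ω‖ ≤ c)
    (hY : StronglyMeasurable[𝓑] Y) (hY1 : ∀ ω, |Y ω| ≤ 1) :
    ‖∫ ω, Y ω • X ω ∂P - P[Y] • P[X]‖ ≤ 4 * a * c := by
  have hYi : Integrable Y P :=
    .of_bound (hY.mono h𝓑).aestronglyMeasurable 1 (Eventually.of_forall hY1)
  refine (League.norm_integral_smul_sub_le (b := 2 * a) h𝓐 hX hXc hYi fun A hA => ?_).trans_eq
    (by ring)
  have hA' := h𝓐 _ hA
  have key := League.norm_integral_smul_sub_le (P := P) (Y := A.indicator fun _ => (1 : ℝ))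
    (b := a) h𝓑 hY hY1 ((integrable_const 1).indicator hA') fun B hB => ?_
  · have e : (fun ω => A.indicator (fun _ => (1 : ℝ)) ω • Y ω) = A.indicator Y := by
      ext ω
      by_cases hω : ω ∈ A <;> simp [hω]
    rwa [e, integral_indicator hA', integral_indicator_const _ hA', smul_eq_mul, smul_eq_mul,
      mul_one, Real.norm_eq_abs, mul_one] at key
  · rw [setIntegral_indicator hA', setIntegral_const, integral_indicator_const _ hA',
      smul_eq_mul, mul_one, smul_eq_mul, mul_one, Set.inter_comm, mul_comm]
    exact h hA hB

end MixingCoefficient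

section StronglyMixingSequences

variable {Ω : Type*} {mΩ : MeasurableSpace Ω}

/-- The `σ`-algebras `𝓜 0, 𝓜 1, …` are strongly mixing with coefficients `a`: the past up to any
time `k` and the future from time `k + n + 1` on have mixing coefficient at most `a n`. The index
of `a` is shifted since the overlap of past and future at lag `0` plays no role. -/
structure IsStronglyMixing (P : Measure Ω) (𝓜 : ℕ → MeasurableSpace Ω) (a : ℕ → ℝ) : Prop where
  le : ∀ d, 𝓜 d ≤ mΩ
  alphaBound : ∀ k n,
    AlphaBound P (⨆ d ∈ Set.Iic k, 𝓜 d) (⨆ d ∈ Set.Ici (k + n + 1), 𝓜 d) (a n)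

/-- The random variables `Z d` are bounded by `1`, centred, and adapted to the `σ`-algebras
`𝓜 d` of the single times `d` (rather than to a filtration). -/
structure IsBoundedCentred (P : Measure Ω) (𝓜 : ℕ → MeasurableSpace Ω) (Z : ℕ → Ω → ℝ) :
    Prop where
  stronglyMeasurable : ∀ d, StronglyMeasurable[𝓜 d] (Z d)
  abs_le_one : ∀ d ω, |Z d ω| ≤ 1
  integral_eq_zero : ∀ d, ∫ ω, Z d ω ∂P = 0

variable {P : Measure Ω} {𝓜 : ℕ → MeasurableSpace Ω} {a : ℕ → ℝ} {Z : ℕ → Ω → ℝ} {τ : ℝ}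
  {k l : ℕ}

lemma IsStronglyMixing.nonneg (hM : IsStronglyMixing P 𝓜 a) (n : ℕ) : 0 ≤ a n :=
  (hM.alphaBound 0 n).nonneg

lemma IsStronglyMixing.norm_integral_smul_sub_le [IsProbabilityMeasure P]
    (hM : IsStronglyMixing P 𝓜 a) {E : Type*} [NormedAddCommGroup E] [NormedSpace ℝ E]
    [CompleteSpace E] {X : Ω → E} {Y : Ω → ℝ} {c : ℝ} {k n : ℕ}
    (hX : StronglyMeasurable[⨆ d ∈ Set.Iic k, 𝓜 d] X) (hXc : ∀ ω, ‖X ω‖ ≤ c)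
    (hY : StronglyMeasurable[⨆ d ∈ Set.Ici (k + n + 1), 𝓜 d] Y) (hY1 : ∀ ω, |Y ω| ≤ 1) :
    ‖∫ ω, Y ω • X ω ∂P - P[Y] • P[X]‖ ≤ 4 * a n * c :=
  (hM.alphaBound k n).norm_integral_smul_sub_le (iSup₂_le fun d _ => hM.le d)
    (iSup₂_le fun d _ => hM.le d) hX hXc hY hY1

lemma norm_integral_sub_integral_le [IsProbabilityMeasure P] {E : Type*} [NormedAddCommGroup E]
    [NormedSpace ℝ E] {f g : Ω → E} {c : ℝ} (hf : Integrable f P) (hg : Integrable g P)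
    (h : ∀ ω, ‖f ω - g ω‖ ≤ c) : ‖∫ ω, f ω ∂P - ∫ ω, g ω ∂P‖ ≤ c := by
  rw [← integral_sub hf hg]
  simpa using norm_integral_le_of_norm_le_const (μ := P) (Eventually.of_forall h)

namespace IsBoundedCentred

lemma stronglyMeasurable_iSup (hZ : IsBoundedCentred P 𝓜 Z) {T : Set ℕ} {d : ℕ} (hd : d ∈ T) :
    StronglyMeasurable[⨆ i ∈ T, 𝓜 i] (Z d) :=
  (hZ.stronglyMeasurable d).mono (le_iSup₂ (f := fun i _ => 𝓜 i) d hd)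

lemma abs_mul_le_one (hZ : IsBoundedCentred P 𝓜 Z) (j k : ℕ) (ω : Ω) : |Z j ω * Z k ω| ≤ 1 := by
  rw [abs_mul]
  exact mul_le_one₀ (hZ.abs_le_one j ω) (abs_nonneg _) (hZ.abs_le_one k ω)

variable [IsProbabilityMeasure P]

lemma abs_integral_mul_le_one (hZ : IsBoundedCentred P 𝓜 Z) (j k : ℕ) :
    |∫ ω, Z j ω * Z k ω ∂P| ≤ 1 := by
  simpa using norm_integral_le_of_norm_le_const (μ := P) (f := fun ω => Z j ω * Z k ω)
    (Eventually.of_forall (hZ.abs_mul_le_one j k))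

lemma norm_integral_smul_le (hM : IsStronglyMixing P 𝓜 a) (hZ : IsBoundedCentred P 𝓜 Z)
    {E : Type*} [NormedAddCommGroup E] [NormedSpace ℝ E] [CompleteSpace E] {X : Ω → E} {c : ℝ}
    {k n : ℕ} (hX : StronglyMeasurable[⨆ d ∈ Set.Iic k, 𝓜 d] X) (hXc : ∀ ω, ‖X ω‖ ≤ c) :
    ‖∫ ω, Z (k + n + 1) ω • X ω ∂P‖ ≤ 4 * a n * c := by
  have h := hM.norm_integral_smul_sub_le hX hXc
    (hZ.stronglyMeasurable_iSup (Set.mem_Ici.2 le_rfl)) (hZ.abs_le_one (k + n + 1))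
  rwa [hZ.integral_eq_zero, zero_smul, sub_zero] at h

lemma abs_integral_mul_le (hM : IsStronglyMixing P 𝓜 a) (hZ : IsBoundedCentred P 𝓜 Z)
    (j n : ℕ) : |∫ ω, Z j ω * Z (j + n + 1) ω ∂P| ≤ 4 * a n := by
  simpa [mul_comm] using hZ.norm_integral_smul_le hM (n := n)
    (hZ.stronglyMeasurable_iSup (Set.mem_Iic.2 (le_refl j))) (hZ.abs_le_one j)

end IsBoundedCentred

/-- The random variable `exp(iτ S_k)`, where `S_k` is the sum of the first `k` terms of `Z`. -/
def expSum (Z : ℕ → Ω → ℝ) (τ : ℝ) (k : ℕ) (ω : Ω) : ℂ :=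
  Complex.exp (Complex.I * (τ * ∑ d ∈ Finset.range k, Z d ω : ℝ))

lemma norm_expSum (Z : ℕ → Ω → ℝ) (τ : ℝ) (k : ℕ) (ω : Ω) : ‖expSum Z τ k ω‖ = 1 :=
  Complex.norm_exp_I_mul_ofReal _

lemma expSum_succ (Z : ℕ → Ω → ℝ) (τ : ℝ) (k : ℕ) (ω : Ω) :
    expSum Z τ (k + 1) ω = expSum Z τ k ω * Complex.exp (Complex.I * (τ * Z k ω : ℝ)) := by
  rw [expSum, expSum, ← Complex.exp_add, ← mul_add, ← Complex.ofReal_add, ← mul_add,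
    Finset.sum_range_succ]

namespace IsBoundedCentred

lemma stronglyMeasurable_expSum (hZ : IsBoundedCentred P 𝓜 Z) (hk : k ≤ l + 1) :
    StronglyMeasurable[⨆ d ∈ Set.Iic l, 𝓜 d] (expSum Z τ k) := by
  have hS : StronglyMeasurable[⨆ d ∈ Set.Iic l, 𝓜 d] fun ω => ∑ d ∈ Finset.range k, Z d ω :=
    Finset.stronglyMeasurable_fun_sum _ fun d hd => hZ.stronglyMeasurable_iSup
      (Set.mem_Iic.2 (by have := Finset.mem_range.1 hd; omega))
  have hexp : Continuous fun x : ℝ => Complex.exp (Complex.I * (τ * x : ℝ)) := by fun_prop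
  exact hexp.comp_stronglyMeasurable hS

lemma norm_expSum_succ_sub_le (hZ : IsBoundedCentred P 𝓜 Z) (k : ℕ) (ω : Ω) :
    ‖expSum Z τ (k + 1) ω - expSum Z τ k ω‖ ≤ |τ| := by
  rw [expSum_succ, ← mul_sub_one, norm_mul, norm_expSum, one_mul]
  refine Real.norm_exp_I_mul_ofReal_sub_one_le.trans ?_
  rw [Real.norm_eq_abs, abs_mul]
  exact mul_le_of_le_one_right (abs_nonneg _) (hZ.abs_le_one k ω)

lemma norm_expSum_sub_le (hZ : IsBoundedCentred P 𝓜 Z) {n : ℕ} (hlk : l ≤ k) (hkn : k ≤ l + n)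
    (ω : Ω) : ‖expSum Z τ k ω - expSum Z τ l ω‖ ≤ |τ| * n := by
  have hsum : ∑ i ∈ Finset.Ico l k, (expSum Z τ (i + 1) ω - expSum Z τ i ω)
      = expSum Z τ k ω - expSum Z τ l ω := Finset.sum_Ico_sub (fun i => expSum Z τ i ω) hlk
  rw [← hsum]
  refine (norm_sum_le_of_le _ fun i _ => hZ.norm_expSum_succ_sub_le i ω).trans ?_
  rw [Finset.sum_const, Nat.card_Ico, nsmul_eq_mul, mul_comm]
  gcongr
  omega

end IsBoundedCentred

/-- A bound for the interaction of two terms of `Z` at distance `i + 1`, obtained either by mixing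
over that distance or by mixing over a gap of length `m` before the earlier term. -/
def interactionError (a : ℕ → ℝ) (τ : ℝ) (m i : ℕ) : ℝ :=
  min (8 * a i) (4 * a m + |τ| * (2 * m + i + 2))

section CharacteristicFunction

variable [IsProbabilityMeasure P]

lemma norm_exp_I_mul_sub_quadratic_le {x : ℝ} (hx : |x| ≤ 1) :
    ‖Complex.exp (Complex.I * x) - (1 + Complex.I * x - (x : ℂ) ^ 2 / 2)‖ ≤ |x| ^ 3 := by
  have hnorm : ‖Complex.I * (x : ℂ)‖ = |x| := by simp
  have hbound := Complex.exp_bound (x := Complex.I * x) (hnorm.trans_le hx) (n := 3) (by norm_num)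
  have hsum : ∑ i ∈ Finset.range 3, (Complex.I * x) ^ i / (i.factorial : ℂ)
      = 1 + Complex.I * x - (x : ℂ) ^ 2 / 2 := by
    simp only [Finset.sum_range_succ, Finset.sum_range_zero, Nat.factorial, mul_pow, Complex.I_sq]
    push_cast
    ring
  rw [hsum, hnorm] at hbound
  refine hbound.trans (mul_le_of_le_one_right (by positivity) ?_)
  norm_num [Nat.factorial]

lemma norm_integral_expSum_le_one (Z : ℕ → Ω → ℝ) (τ : ℝ) (k : ℕ) : ‖P[expSum Z τ k]‖ ≤ 1 := by
  simpa using norm_integral_le_of_norm_le_const (μ := P)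
    (Eventually.of_forall fun ω => (norm_expSum Z τ k ω).le)

namespace IsBoundedCentred

lemma integrable (hM : IsStronglyMixing P 𝓜 a) (hZ : IsBoundedCentred P 𝓜 Z) (d : ℕ) :
    Integrable (Z d) P :=
  .of_bound ((hZ.stronglyMeasurable d).mono (hM.le d)).aestronglyMeasurable 1
    (Eventually.of_forall (hZ.abs_le_one d))

lemma integrable_mul (hM : IsStronglyMixing P 𝓜 a) (hZ : IsBoundedCentred P 𝓜 Z) (j k : ℕ) :
    Integrable (fun ω => Z j ω * Z k ω) P :=
  (hZ.integrable hM k).bdd_mul (hZ.integrable hM j).aestronglyMeasurable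
    (Eventually.of_forall (hZ.abs_le_one j))

lemma integrable_expSum (hM : IsStronglyMixing P 𝓜 a) (hZ : IsBoundedCentred P 𝓜 Z) (k : ℕ) :
    Integrable (expSum Z τ k) P :=
  .of_bound ((hZ.stronglyMeasurable_expSum k.le_succ).mono
    (iSup₂_le fun d _ => hM.le d)).aestronglyMeasurable 1
    (Eventually.of_forall fun ω => (norm_expSum Z τ k ω).le)

lemma integrable_smul_expSum (hM : IsStronglyMixing P 𝓜 a) (hZ : IsBoundedCentred P 𝓜 Z)
    {Y : Ω → ℝ} (hY : Integrable Y P) (k : ℕ) :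
    Integrable (fun ω => Y ω • expSum Z τ k ω) P :=
  hY.smul_bdd 1 (hZ.integrable_expSum hM k).aestronglyMeasurable
    (Eventually.of_forall fun ω => (norm_expSum Z τ k ω).le)

lemma norm_integral_mul_smul_expSum_tsub_sub_le (hM : IsStronglyMixing P 𝓜 a)
    (hZ : IsBoundedCentred P 𝓜 Z) (j n m : ℕ) :
    ‖∫ ω, (Z j ω * Z (j + n) ω) • expSum Z τ (j - m) ω ∂P
      - (∫ ω, Z j ω * Z (j + n) ω ∂P) • P[expSum Z τ (j - m)]‖ ≤ 4 * a m := by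
  rcases le_or_gt j m with hjm | hmj
  · simp [expSum, Nat.sub_eq_zero_of_le hjm, -Complex.ofReal_mul, integral_complex_ofReal,
      hM.nonneg m]
  · have hmem : ∀ i, StronglyMeasurable[⨆ d ∈ Set.Ici (j - m - 1 + m + 1), 𝓜 d] (Z (j + i)) :=
      fun i => hZ.stronglyMeasurable_iSup (Set.mem_Ici.2 (by omega))
    exact (hM.norm_integral_smul_sub_le (k := j - m - 1) (hZ.stronglyMeasurable_expSum (by omega))
      (fun ω => (norm_expSum Z τ _ ω).le) ((hmem 0).mul (hmem n))
      (hZ.abs_mul_le_one _ _)).trans_eq (mul_one _)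

/- Without its last `m` terms, the sum in the exponential is decoupled from `Z j * Z (j + n)`. -/
lemma norm_integral_mul_smul_expSum_sub_le (hM : IsStronglyMixing P 𝓜 a)
    (hZ : IsBoundedCentred P 𝓜 Z) (j n m : ℕ) :
    ‖∫ ω, (Z j ω * Z (j + n) ω) • expSum Z τ j ω ∂P
      - (∫ ω, Z j ω * Z (j + n) ω ∂P) • P[expSum Z τ (j + n)]‖
      ≤ 4 * a m + |τ| * (2 * m + n) := by
  have hint := hZ.integrable_smul_expSum (τ := τ) hM (hZ.integrable_mul hM j (j + n))
  have hremove : ‖∫ ω, (Z j ω * Z (j + n) ω) • expSum Z τ j ω ∂P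
      - ∫ ω, (Z j ω * Z (j + n) ω) • expSum Z τ (j - m) ω ∂P‖ ≤ |τ| * m :=
    norm_integral_sub_integral_le (hint _) (hint _) fun ω => by
      rw [← smul_sub, norm_smul]
      exact (mul_le_of_le_one_left (norm_nonneg _) (hZ.abs_mul_le_one _ _ ω)).trans
        (hZ.norm_expSum_sub_le (by omega) (by omega) ω)
  have hrestore : ‖(∫ ω, Z j ω * Z (j + n) ω ∂P) • P[expSum Z τ (j - m)]
      - (∫ ω, Z j ω * Z (j + n) ω ∂P) • P[expSum Z τ (j + n)]‖ ≤ |τ| * (m + n : ℕ) := by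
    rw [← smul_sub, norm_smul, norm_sub_rev]
    exact (mul_le_of_le_one_left (norm_nonneg _) (hZ.abs_integral_mul_le_one _ _)).trans
      (norm_integral_sub_integral_le (hZ.integrable_expSum hM _) (hZ.integrable_expSum hM _)
        (hZ.norm_expSum_sub_le (by omega) (by omega)))
  have hdecouple := hZ.norm_integral_mul_smul_expSum_tsub_sub_le (τ := τ) hM j n m
  rw [← dist_eq_norm] at hremove hdecouple hrestore ⊢
  calc _ ≤ _ := (dist_triangle4 _ _ _ _).trans (add_le_add_three hremove hdecouple hrestore)
    _ = _ := by push_cast; ring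

lemma norm_integral_smul_expSum_succ_sub_le (hM : IsStronglyMixing P 𝓜 a)
    (hZ : IsBoundedCentred P 𝓜 Z) (j n : ℕ) :
    ‖∫ ω, Z (j + n + 1) ω • (expSum Z τ (j + 1) ω - expSum Z τ j ω) ∂P‖ ≤ 4 * a n * |τ| :=
  hZ.norm_integral_smul_le hM ((hZ.stronglyMeasurable_expSum le_rfl).sub
    (hZ.stronglyMeasurable_expSum j.le_succ)) (hZ.norm_expSum_succ_sub_le j)

lemma norm_integral_smul_expSum_succ_sub_sub_le (hM : IsStronglyMixing P 𝓜 a)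
    (hZ : IsBoundedCentred P 𝓜 Z) (hτ : |τ| ≤ 1) (j n : ℕ) :
    ‖∫ ω, Z (j + n) ω • (expSum Z τ (j + 1) ω - expSum Z τ j ω) ∂P
      - Complex.I * τ * ∫ ω, (Z j ω * Z (j + n) ω) • expSum Z τ j ω ∂P‖ ≤ |τ| ^ 2 := by
  have hpoint : ∀ ω, ‖Z (j + n) ω • (expSum Z τ (j + 1) ω - expSum Z τ j ω)
      - Complex.I * τ * (Z j ω * Z (j + n) ω) • expSum Z τ j ω‖ ≤ |τ| ^ 2 := fun ω => by
    set x : ℂ := Complex.I * (τ * Z j ω : ℝ) with hx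
    have hxτ : ‖x‖ ≤ |τ| := by
      rw [hx, norm_mul, Complex.norm_I, one_mul, Complex.norm_real, Real.norm_eq_abs, abs_mul]
      exact mul_le_of_le_one_right (abs_nonneg _) (hZ.abs_le_one j ω)
    calc _ = ‖Z (j + n) ω • (expSum Z τ j ω * (Complex.exp x - 1 - x))‖ := by
          rw [expSum_succ, ← hx]
          simp only [hx, Complex.real_smul]
          push_cast
          ring_nf
      _ ≤ ‖x‖ ^ 2 := by
          rw [norm_smul, norm_mul, norm_expSum, one_mul]
          exact (mul_le_of_le_one_left (norm_nonneg _) (hZ.abs_le_one _ ω)).trans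
            (Complex.norm_exp_sub_one_sub_id_le (hxτ.trans hτ))
      _ ≤ |τ| ^ 2 := by gcongr
  rw [← integral_const_mul]
  refine norm_integral_sub_integral_le ?_ ?_ hpoint
  · simp only [smul_sub]
    exact (hZ.integrable_smul_expSum hM (hZ.integrable hM _) _).sub
      (hZ.integrable_smul_expSum hM (hZ.integrable hM _) _)
  · exact (hZ.integrable_smul_expSum hM (hZ.integrable_mul hM _ _) _).const_mul _

lemma norm_integral_smul_expSum_succ_sub_sub_le_interactionError (hM : IsStronglyMixing P 𝓜 a)
    (hZ : IsBoundedCentred P 𝓜 Z) (hτ : |τ| ≤ 1) (m j n : ℕ) :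
    ‖∫ ω, Z (j + n + 1) ω • (expSum Z τ (j + 1) ω - expSum Z τ j ω) ∂P
      - Complex.I * τ * ((∫ ω, Z j ω * Z (j + n + 1) ω ∂P) • P[expSum Z τ (j + n + 1)])‖
      ≤ |τ| * interactionError a τ m n := by
  have hnorm : ‖Complex.I * (τ : ℂ)‖ = |τ| := by simp
  rw [interactionError, mul_min_of_nonneg _ _ (abs_nonneg _)]
  refine le_min ?_ ?_
  · have hcov : ‖Complex.I * τ * ((∫ ω, Z j ω * Z (j + n + 1) ω ∂P) •
        P[expSum Z τ (j + n + 1)])‖ ≤ |τ| * (4 * a n) := by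
      rw [norm_mul, hnorm, norm_smul, Real.norm_eq_abs]
      exact mul_le_mul_of_nonneg_left ((mul_le_of_le_one_right (abs_nonneg _)
        (norm_integral_expSum_le_one Z τ _)).trans (hZ.abs_integral_mul_le hM j n)) (abs_nonneg τ)
    linarith [(norm_sub_le _ _).trans
      (add_le_add (hZ.norm_integral_smul_expSum_succ_sub_le (τ := τ) hM j n) hcov)]
  · have htaylor := hZ.norm_integral_smul_expSum_succ_sub_sub_le hM hτ j (n + 1)
    have hdecouple := hZ.norm_integral_mul_smul_expSum_sub_le (τ := τ) hM j (n + 1) m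
    have h := norm_sub_le_norm_sub_add_norm_sub (∫ ω, Z (j + (n + 1)) ω • (expSum Z τ (j + 1) ω -
      expSum Z τ j ω) ∂P) (Complex.I * τ * ∫ ω, (Z j ω * Z (j + (n + 1)) ω) • expSum Z τ j ω ∂P)
      (Complex.I * τ * ((∫ ω, Z j ω * Z (j + (n + 1)) ω ∂P) • P[expSum Z τ (j + (n + 1))]))
    rw [← mul_sub (Complex.I * (τ : ℂ)), norm_mul, hnorm] at h
    calc _ ≤ _ := h.trans (add_le_add htaylor (mul_le_mul_of_nonneg_left hdecouple (abs_nonneg τ)))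
      _ = _ := by push_cast; ring

lemma norm_integral_smul_expSum_sub_le (hM : IsStronglyMixing P 𝓜 a)
    (hZ : IsBoundedCentred P 𝓜 Z) (hτ : |τ| ≤ 1) (m k : ℕ) :
    ‖∫ ω, Z k ω • expSum Z τ k ω ∂P
      - Complex.I * τ * ((∑ j ∈ Finset.range k, ∫ ω, Z j ω * Z k ω ∂P) • P[expSum Z τ k])‖
      ≤ |τ| * ∑ i ∈ Finset.range k, interactionError a τ m i := by
  have hint : ∀ j, Integrable (fun ω => Z k ω • expSum Z τ j ω) P :=
    hZ.integrable_smul_expSum hM (hZ.integrable hM k)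
  have htelescope : ∫ ω, Z k ω • expSum Z τ k ω ∂P = ∑ j ∈ Finset.range k,
      ∫ ω, Z k ω • (expSum Z τ (j + 1) ω - expSum Z τ j ω) ∂P := by
    have hzero : ∫ ω, Z k ω • expSum Z τ 0 ω ∂P = 0 := by
      simp [expSum, integral_complex_ofReal, hZ.integral_eq_zero]
    simp_rw [smul_sub, fun j => integral_sub (hint (j + 1)) (hint j)]
    rw [Finset.sum_range_sub (fun j => ∫ ω, Z k ω • expSum Z τ j ω ∂P), hzero, sub_zero]
  rw [htelescope, Finset.sum_smul, Finset.mul_sum, ← Finset.sum_sub_distrib, Finset.mul_sum,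
    ← Finset.sum_range_reflect (fun i => |τ| * interactionError a τ m i)]
  refine norm_sum_le_of_le _ fun j hj => ?_
  obtain ⟨n, rfl⟩ := Nat.exists_eq_add_of_lt (Finset.mem_range.1 hj)
  rw [show j + n + 1 - 1 - j = n by omega]
  exact hZ.norm_integral_smul_expSum_succ_sub_sub_le_interactionError hM hτ m j n

lemma norm_integral_expSum_succ_sub_le (hM : IsStronglyMixing P 𝓜 a)
    (hZ : IsBoundedCentred P 𝓜 Z) (hτ : |τ| ≤ 1) (k : ℕ) :
    ‖P[expSum Z τ (k + 1)] - (P[expSum Z τ k] + Complex.I * τ * ∫ ω, Z k ω • expSum Z τ k ω ∂P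
      - τ ^ 2 / 2 * ∫ ω, (Z k ω * Z k ω) • expSum Z τ k ω ∂P)‖ ≤ |τ| ^ 3 := by
  have hpoint : ∀ ω, ‖expSum Z τ (k + 1) ω - (expSum Z τ k ω
      + Complex.I * τ * Z k ω • expSum Z τ k ω
      - τ ^ 2 / 2 * (Z k ω * Z k ω) • expSum Z τ k ω)‖ ≤ |τ| ^ 3 := fun ω => by
    have hxτ : |τ * Z k ω| ≤ |τ| := by
      rw [abs_mul]
      exact mul_le_of_le_one_right (abs_nonneg _) (hZ.abs_le_one k ω)
    calc _ = ‖expSum Z τ k ω * (Complex.exp (Complex.I * (τ * Z k ω : ℝ))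
          - (1 + Complex.I * (τ * Z k ω : ℝ) - ((τ * Z k ω : ℝ) : ℂ) ^ 2 / 2))‖ := by
          rw [expSum_succ]
          simp only [Complex.real_smul]
          push_cast
          ring_nf
      _ ≤ |τ * Z k ω| ^ 3 := by
          rw [norm_mul, norm_expSum, one_mul]
          exact norm_exp_I_mul_sub_quadratic_le (hxτ.trans hτ)
      _ ≤ |τ| ^ 3 := by gcongr
  have hint := hZ.integrable_expSum (τ := τ) hM
  have hint1 := (hZ.integrable_smul_expSum (τ := τ) hM (hZ.integrable hM k) k).const_mul
    (Complex.I * τ)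
  have hint2 := (hZ.integrable_smul_expSum (τ := τ) hM (hZ.integrable_mul hM k k) k).const_mul
    ((τ : ℂ) ^ 2 / 2)
  have hint01 : Integrable (fun ω => expSum Z τ k ω
      + Complex.I * τ * Z k ω • expSum Z τ k ω) P := (hint k).add hint1
  rw [← integral_const_mul, ← integral_const_mul, ← integral_add (hint k) hint1,
    ← integral_sub hint01 hint2]
  exact norm_integral_sub_integral_le (hint _) (hint01.sub hint2) hpoint

lemma integral_sq_sum_range_succ_sub (hM : IsStronglyMixing P 𝓜 a)
    (hZ : IsBoundedCentred P 𝓜 Z) (k : ℕ) :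
    ∫ ω, (∑ d ∈ Finset.range (k + 1), Z d ω) ^ 2 ∂P - ∫ ω, (∑ d ∈ Finset.range k, Z d ω) ^ 2 ∂P
      = ∫ ω, Z k ω * Z k ω ∂P + 2 * ∑ j ∈ Finset.range k, ∫ ω, Z j ω * Z k ω ∂P := by
  have hsq : ∀ k, Integrable (fun ω => (∑ d ∈ Finset.range k, Z d ω) ^ 2) P := fun k => by
    simp_rw [sq, Finset.sum_mul_sum]
    exact integrable_finsetSum _ fun i _ => integrable_finsetSum _ fun j _ =>
      hZ.integrable_mul hM i j
  have hcross : ∀ j, Integrable (fun ω => Z j ω * Z k ω) P := fun j => hZ.integrable_mul hM j k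
  rw [← integral_finsetSum _ fun j _ => hcross j, ← integral_const_mul,
    ← integral_add (hcross k) ((integrable_finsetSum _ fun j _ => hcross j).const_mul 2),
    ← integral_sub (hsq _) (hsq _)]
  congr with ω
  rw [Finset.sum_range_succ, ← Finset.sum_mul]
  ring

lemma sum_abs_integral_mul_le (hM : IsStronglyMixing P 𝓜 a) (hZ : IsBoundedCentred P 𝓜 Z)
    (ha : Summable a) (k : ℕ) :
    ∑ j ∈ Finset.range k, |∫ ω, Z j ω * Z k ω ∂P| ≤ 4 * ∑' i, a i := by
  calc _ ≤ ∑ j ∈ Finset.range k, 4 * a (k - 1 - j) := Finset.sum_le_sum fun j hj => by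
        obtain ⟨n, rfl⟩ := Nat.exists_eq_add_of_lt (Finset.mem_range.1 hj)
        rw [show j + n + 1 - 1 - j = n by omega]
        exact hZ.abs_integral_mul_le hM j n
    _ = 4 * ∑ i ∈ Finset.range k, a i := by
        rw [Finset.sum_range_reflect (fun i => 4 * a i), ← Finset.mul_sum]
    _ ≤ 4 * ∑' i, a i := by
        gcongr
        exact ha.sum_le_tsum _ fun i _ => hM.nonneg i

lemma abs_integral_sq_sum_range_succ_sub_le (hM : IsStronglyMixing P 𝓜 a)
    (hZ : IsBoundedCentred P 𝓜 Z) (ha : Summable a) (k : ℕ) :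
    |∫ ω, (∑ d ∈ Finset.range (k + 1), Z d ω) ^ 2 ∂P - ∫ ω, (∑ d ∈ Finset.range k, Z d ω) ^ 2 ∂P|
      ≤ 1 + 8 * ∑' i, a i := by
  rw [hZ.integral_sq_sum_range_succ_sub hM]
  have hsum := (Finset.abs_sum_le_sum_abs _ _).trans (hZ.sum_abs_integral_mul_le hM ha k)
  calc _ ≤ _ := abs_add_le _ _
    _ ≤ 1 + 2 * (4 * ∑' i, a i) := by
        rw [abs_mul, abs_two]
        gcongr
        exact hZ.abs_integral_mul_le_one k k
    _ = _ := by ring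

end IsBoundedCentred

lemma interactionError_nonneg (ha : ∀ i, 0 ≤ a i) (τ : ℝ) (m i : ℕ) :
    0 ≤ interactionError a τ m i := by
  have := ha i
  have := ha m
  rw [interactionError]
  positivity

lemma summable_interactionError (ha : ∀ i, 0 ≤ a i) (hsum : Summable a) (τ : ℝ) (m : ℕ) :
    Summable (interactionError a τ m) :=
  .of_nonneg_of_le (interactionError_nonneg ha τ m) (fun _ => min_le_left _ _) (hsum.mul_left 8)

/-- The error, divided by `τ²`, of replacing `φ (k + 1)` by `(1 - τ² (E[S (k + 1)²] - E[S k²]) / 2)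
φ k`, where `S k` is the sum of the first `k` terms of a strongly mixing sequence and `φ k` is the
characteristic function of `S k` at `τ`. -/
def stepError (a : ℕ → ℝ) (τ : ℝ) (m : ℕ) : ℝ :=
  ∑' i, interactionError a τ m i + 2 * a m + |τ| * (m + 1)

lemma IsBoundedCentred.norm_integral_expSum_succ_sub_mul_le (hM : IsStronglyMixing P 𝓜 a)
    (hZ : IsBoundedCentred P 𝓜 Z) (ha : Summable a) (hτ : |τ| ≤ 1) (m k : ℕ) :
    ‖P[expSum Z τ (k + 1)] - (1 - ((τ ^ 2 / 2 * ∫ ω, (∑ d ∈ Finset.range (k + 1), Z d ω) ^ 2 ∂P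
      - τ ^ 2 / 2 * ∫ ω, (∑ d ∈ Finset.range k, Z d ω) ^ 2 ∂P : ℝ) : ℂ)) * P[expSum Z τ k]‖
      ≤ τ ^ 2 * stepError a τ m := by
  have htaylor := hZ.norm_integral_expSum_succ_sub_le hM hτ k
  have hfirst := hZ.norm_integral_smul_expSum_sub_le hM hτ m k
  have hsecond := hZ.norm_integral_mul_smul_expSum_sub_le (τ := τ) hM k 0 m
  have hsum : ∑ i ∈ Finset.range k, interactionError a τ m i ≤ ∑' i, interactionError a τ m i :=
    (summable_interactionError hM.nonneg ha τ m).sum_le_tsum _ fun i _ =>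
      interactionError_nonneg hM.nonneg τ m i
  rw [← mul_sub, hZ.integral_sq_sum_range_succ_sub hM]
  simp only [add_zero, Nat.cast_zero, Complex.real_smul] at htaylor hfirst hsecond
  set φ := P[expSum Z τ k]
  set x := ∫ ω, Z k ω * expSum Z τ k ω ∂P
  set y := ∫ ω, ((Z k ω * Z k ω : ℝ) : ℂ) * expSum Z τ k ω ∂P
  set p := ∫ ω, Z k ω * Z k ω ∂P
  set q := ∑ j ∈ Finset.range k, ∫ ω, Z j ω * Z k ω ∂P
  have hnorm : ‖Complex.I * (τ : ℂ)‖ = |τ| := by simp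
  have hnorm2 : ‖(τ : ℂ) ^ 2 / 2‖ = τ ^ 2 / 2 := by simp
  have hτ2 : |τ| ^ 2 = τ ^ 2 := sq_abs τ
  calc _ = ‖(P[expSum Z τ (k + 1)] - (φ + Complex.I * τ * x - τ ^ 2 / 2 * y))
        + Complex.I * τ * (x - Complex.I * τ * (q * φ)) - τ ^ 2 / 2 * (y - p * φ)‖ := by
        congr 1
        push_cast
        linear_combination (τ ^ 2 * q * φ) * Complex.I_sq
    _ ≤ |τ| ^ 3 + |τ| * (|τ| * ∑' i, interactionError a τ m i)
        + τ ^ 2 / 2 * (4 * a m + |τ| * (2 * m)) := by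
        refine norm_sub_le_of_le (norm_add_le_of_le htaylor ?_) ?_
        · rw [norm_mul, hnorm]
          gcongr
          exact hfirst.trans (by gcongr)
        · rw [norm_mul, hnorm2]
          gcongr
    _ = τ ^ 2 * stepError a τ m := by
        rw [stepError]
        linear_combination (|τ| + ∑' i, interactionError a τ m i) * hτ2

lemma norm_sub_exp_neg_le {z : ℕ → ℂ} {v : ℕ → ℝ} {c δ : ℝ} (hz0 : z 0 = 1) (hv0 : v 0 = 0)
    (hz : ∀ k, ‖z k‖ ≤ 1) (hc : c ≤ 1) (hv : ∀ k, |v (k + 1) - v k| ≤ c)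
    (hstep : ∀ k, ‖z (k + 1) - (1 - ((v (k + 1) - v k : ℝ) : ℂ)) * z k‖ ≤ δ) (k : ℕ) :
    ‖z k - Real.exp (-v k)‖ ≤ k * (δ + c ^ 2) * Real.exp (k * c) := by
  have hc0 : 0 ≤ c := (abs_nonneg _).trans (hv 0)
  have hδ0 : 0 ≤ δ := (norm_nonneg _).trans (hstep 0)
  induction k with
  | zero => simp [hz0, hv0]
  | succ k ih =>
    set Δ := v (k + 1) - v k with hΔ
    have hquad : ‖(1 - (Δ : ℂ)) - Real.exp (-Δ)‖ ≤ c ^ 2 := by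
      have h := Real.norm_exp_sub_one_sub_id_le (x := -Δ) (by simpa using (hv k).trans hc)
      rw [← Complex.ofReal_one, ← Complex.ofReal_sub, ← Complex.ofReal_sub, Complex.norm_real,
        norm_sub_rev]
      calc ‖Real.exp (-Δ) - (1 - Δ)‖ = ‖Real.exp (-Δ) - 1 - -Δ‖ := by ring_nf
        _ ≤ ‖-Δ‖ ^ 2 := h
        _ ≤ c ^ 2 := by
          rw [norm_neg]
          exact pow_le_pow_left₀ (norm_nonneg _) (hv k) 2
    have hexp : Real.exp (-Δ) ≤ Real.exp c := Real.exp_le_exp.2 ((neg_le_abs Δ).trans (hv k))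
    have hprod : Real.exp (-v (k + 1)) = Real.exp (-Δ) * Real.exp (-v k) := by
      rw [← Real.exp_add, hΔ]
      ring_nf
    have hone : 1 ≤ Real.exp ((k + 1) * c) := Real.one_le_exp (by positivity)
    calc _ = ‖(z (k + 1) - (1 - Δ) * z k) + ((1 - Δ) - Real.exp (-Δ)) * z k
          + Real.exp (-Δ) * (z k - Real.exp (-v k))‖ := by
          rw [hprod]
          push_cast
          ring_nf
      _ ≤ δ + c ^ 2 * 1 + Real.exp c * (k * (δ + c ^ 2) * Real.exp (k * c)) := by
          refine norm_add_le_of_le (norm_add_le_of_le (hstep k) ?_) ?_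
          · rw [norm_mul]
            gcongr
            exact hz k
          · rw [norm_mul, Complex.norm_real, Real.norm_of_nonneg (Real.exp_pos _).le]
            gcongr
      _ = (δ + c ^ 2) * 1 + k * (δ + c ^ 2) * Real.exp ((k + 1) * c) := by
          rw [add_mul (k : ℝ), one_mul, Real.exp_add]
          ring
      _ ≤ (δ + c ^ 2) * Real.exp ((k + 1) * c) + k * (δ + c ^ 2) * Real.exp ((k + 1) * c) := by
          gcongr
      _ = _ := by
          push_cast
          ring

lemma stepError_nonneg (ha : ∀ i, 0 ≤ a i) (τ : ℝ) (m : ℕ) : 0 ≤ stepError a τ m := by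
  have := ha m
  have : 0 ≤ ∑' i, interactionError a τ m i := tsum_nonneg (interactionError_nonneg ha τ m)
  rw [stepError]
  positivity

lemma tendsto_stepError_zero (ha : ∀ i, 0 ≤ a i) (hsum : Summable a) (m : ℕ) :
    Tendsto (fun τ => stepError a τ m) (𝓝 0) (𝓝 (stepError a 0 m)) := by
  have hterm : ∀ i, Continuous fun τ => interactionError a τ m i := fun i => by
    unfold interactionError
    fun_prop
  have hcont : Continuous fun τ => ∑' i, interactionError a τ m i :=
    continuous_tsum hterm (hsum.mul_left 8) fun i τ => by
      rw [Real.norm_of_nonneg (interactionError_nonneg ha τ m i)]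
      exact min_le_left _ _
  have hstep : Continuous fun τ => stepError a τ m := by
    unfold stepError
    fun_prop
  exact hstep.tendsto 0

lemma tendsto_stepError_zero_atTop (ha : ∀ i, 0 ≤ a i) (hsum : Summable a) :
    Tendsto (stepError a 0) atTop (𝓝 0) := by
  have ha0 := hsum.tendsto_atTop_zero
  have hterm : ∀ i, Tendsto (fun m => interactionError a 0 m i) atTop (𝓝 0) := fun i => by
    have h := (tendsto_const_nhds (x := 8 * a i)).min (ha0.const_mul 4)
    simpa [interactionError, ha i] using h
  have htsum : Tendsto (fun m => ∑' i, interactionError a 0 m i) atTop (𝓝 (∑' _ : ℕ, 0)) :=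
    tendsto_tsum_of_dominated_convergence (hsum.mul_left 8) hterm <| Eventually.of_forall
      fun m i => by
        rw [Real.norm_of_nonneg (interactionError_nonneg ha 0 m i)]
        exact min_le_left _ _
  have h := htsum.add (ha0.const_mul 2)
  unfold stepError
  simpa using h

lemma tendsto_iInf_stepError (ha : ∀ i, 0 ≤ a i) (hsum : Summable a) :
    Tendsto (fun τ => ⨅ m, stepError a τ m) (𝓝 0) (𝓝 0) := by
  refine tendsto_order.2 ⟨fun x hx => .of_forall fun τ =>
    hx.trans_le (Real.iInf_nonneg (stepError_nonneg ha τ)), fun ε hε => ?_⟩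
  obtain ⟨m, hm⟩ := ((tendsto_stepError_zero_atTop ha hsum).eventually_lt_const hε).exists
  filter_upwards [(tendsto_stepError_zero ha hsum m).eventually_lt_const hm] with τ hτ
  exact (ciInf_le ⟨0, Set.forall_mem_range.2 (stepError_nonneg ha τ)⟩ m).trans_lt hτ

lemma IsBoundedCentred.norm_integral_expSum_sub_exp_le (hM : IsStronglyMixing P 𝓜 a)
    (hZ : IsBoundedCentred P 𝓜 Z) (ha : Summable a) (hτ : |τ| ≤ 1) {K : ℝ}
    (hK : 1 + 8 * ∑' i, a i ≤ K) (hτK : τ ^ 2 * K ≤ 1) (k : ℕ) :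
    ‖P[expSum Z τ k]
      - ((Real.exp (-(τ ^ 2 / 2 * ∫ ω, (∑ d ∈ Finset.range k, Z d ω) ^ 2 ∂P)) : ℝ) : ℂ)‖
      ≤ k * τ ^ 2 * ((⨅ m, stepError a τ m) + τ ^ 2 * K ^ 2) * Real.exp (k * τ ^ 2 * K) := by
  have hstep : ∀ k, ‖P[expSum Z τ (k + 1)] - (1 - ((τ ^ 2 / 2 *
      ∫ ω, (∑ d ∈ Finset.range (k + 1), Z d ω) ^ 2 ∂P
      - τ ^ 2 / 2 * ∫ ω, (∑ d ∈ Finset.range k, Z d ω) ^ 2 ∂P : ℝ) : ℂ)) * P[expSum Z τ k]‖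
      ≤ τ ^ 2 * ⨅ m, stepError a τ m := fun k => by
    rw [Real.mul_iInf_of_nonneg (sq_nonneg τ)]
    exact le_ciInf fun m => hZ.norm_integral_expSum_succ_sub_mul_le hM ha hτ m k
  have hv : ∀ k, |τ ^ 2 / 2 * ∫ ω, (∑ d ∈ Finset.range (k + 1), Z d ω) ^ 2 ∂P
      - τ ^ 2 / 2 * ∫ ω, (∑ d ∈ Finset.range k, Z d ω) ^ 2 ∂P| ≤ τ ^ 2 * K := fun k => by
    rw [← mul_sub, abs_mul, abs_of_nonneg (by positivity)]
    gcongr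
    · linarith [sq_nonneg τ]
    · exact (hZ.abs_integral_sq_sum_range_succ_sub_le hM ha k).trans hK
  have hz0 : P[expSum Z τ 0] = 1 := by simp [expSum]
  have hgronwall := norm_sub_exp_neg_le (z := fun k => P[expSum Z τ k])
    (v := fun k => τ ^ 2 / 2 * ∫ ω, (∑ d ∈ Finset.range k, Z d ω) ^ 2 ∂P) hz0 (by simp)
    (norm_integral_expSum_le_one Z τ) hτK hv hstep k
  refine hgronwall.trans_eq ?_
  rw [← mul_assoc]
  ring

theorem tendsto_integral_expSum (hM : IsStronglyMixing P 𝓜 a) (ha : Summable a)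
    {Z : ℕ → ℕ → Ω → ℝ} (hZ : ∀ n, IsBoundedCentred P 𝓜 (Z n)) {N : ℕ → ℕ} {τ : ℕ → ℝ} {b v : ℝ}
    (hτ : Tendsto τ atTop (𝓝 0)) (hN : ∀ n, N n * τ n ^ 2 ≤ b)
    (hv : Tendsto (fun n => τ n ^ 2 / 2 * ∫ ω, (∑ d ∈ Finset.range (N n), Z n d ω) ^ 2 ∂P)
      atTop (𝓝 v)) :
    Tendsto (fun n => P[expSum (Z n) (τ n) (N n)]) atTop (𝓝 ((Real.exp (-v) : ℝ) : ℂ)) := by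
  have hb : 0 ≤ b := le_trans (by positivity) (hN 0)
  set K := 1 + 8 * ∑' i, a i
  have hK : 0 ≤ K := by
    have : 0 ≤ ∑' i, a i := tsum_nonneg hM.nonneg
    positivity
  have hτ2 : Tendsto (fun n => τ n ^ 2) atTop (𝓝 0) := by simpa using hτ.pow 2
  have herror : Tendsto (fun n => b * ((⨅ m, stepError a (τ n) m) + τ n ^ 2 * K ^ 2)
      * Real.exp (b * K)) atTop (𝓝 0) := by
    simpa using ((((tendsto_iInf_stepError hM.nonneg ha).comp hτ).add
      (hτ2.mul_const (K ^ 2))).const_mul b).mul_const (Real.exp (b * K))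
  have hlimit : Tendsto (fun n => ((Real.exp (-(τ n ^ 2 / 2 *
      ∫ ω, (∑ d ∈ Finset.range (N n), Z n d ω) ^ 2 ∂P)) : ℝ) : ℂ)) atTop
      (𝓝 ((Real.exp (-v) : ℝ) : ℂ)) :=
    (Complex.continuous_ofReal.tendsto _).comp ((Real.continuous_exp.tendsto _).comp hv.neg)
  have hdiff : Tendsto (fun n => P[expSum (Z n) (τ n) (N n)] - ((Real.exp (-(τ n ^ 2 / 2 *
      ∫ ω, (∑ d ∈ Finset.range (N n), Z n d ω) ^ 2 ∂P)) : ℝ) : ℂ)) atTop (𝓝 0) := by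
    refine squeeze_zero_norm' ?_ herror
    have hτ1 : ∀ᶠ n in atTop, |τ n| < 1 := hτ.abs.eventually_lt_const (by simp)
    have hτK : ∀ᶠ n in atTop, τ n ^ 2 * K < 1 :=
      (hτ2.mul_const K).eventually_lt_const (by simp)
    filter_upwards [hτ1, hτK] with n hn1 hnK
    refine ((hZ n).norm_integral_expSum_sub_exp_le hM ha hn1.le le_rfl hnK.le (N n)).trans ?_
    have : 0 ≤ ⨅ m, stepError a (τ n) m := Real.iInf_nonneg (stepError_nonneg hM.nonneg (τ n))
    have hNn := hN n
    gcongr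
  simpa only [sub_add_cancel, zero_add] using hdiff.add hlimit

theorem tendstoInDistribution_sum_div_sqrt (hM : IsStronglyMixing P 𝓜 a) (ha : Summable a)
    {Z : ℕ → ℕ → Ω → ℝ} (hZ : ∀ n, IsBoundedCentred P 𝓜 (Z n)) {N : ℕ → ℕ} {b : ℕ → ℝ} {v : ℝ≥0}
    (hb : Tendsto b atTop atTop) (hN : ∀ n, N n ≤ b n)
    (hv : Tendsto (fun n => (∫ ω, (∑ d ∈ Finset.range (N n), Z n d ω) ^ 2 ∂P) / b n)
      atTop (𝓝 v)) :
    TendstoInDistribution (fun n ω => (∑ d ∈ Finset.range (N n), Z n d ω) / √(b n)) atTop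
      (id : ℝ → ℝ) (fun _ => P) (gaussianReal 0 v) := by
  have hb0 : ∀ n, 0 ≤ b n := fun n => (Nat.cast_nonneg _).trans (hN n)
  have hmeas : ∀ n, AEMeasurable (fun ω => (∑ d ∈ Finset.range (N n), Z n d ω) / √(b n)) P :=
    fun n => (Finset.aemeasurable_fun_sum _ fun d _ =>
      ((hZ n).integrable hM d).aemeasurable).div_const _
  refine ⟨hmeas, by fun_prop, ProbabilityMeasure.tendsto_iff_tendsto_charFun.2 fun t => ?_⟩
  have hsq : ∀ n, (t / √(b n)) ^ 2 = t ^ 2 * (b n)⁻¹ := fun n => by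
    rw [div_pow, Real.sq_sqrt (hb0 n), div_eq_mul_inv]
  have hlimit := tendsto_integral_expSum hM ha hZ (τ := fun n => t / √(b n)) (N := N) (b := t ^ 2)
    (v := t ^ 2 / 2 * v) ((Real.tendsto_sqrt_atTop.comp hb).const_div_atTop t)
    (fun n => by
      rw [hsq, mul_left_comm]
      exact mul_le_of_le_one_right (sq_nonneg t) (div_le_one_of_le₀ (hN n) (hb0 n)))
    ((hv.const_mul (t ^ 2 / 2)).congr fun n => by rw [hsq]; ring)
  have hgauss : charFun ((gaussianReal 0 v).map id) t = Real.exp (-(t ^ 2 / 2 * v)) := by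
    rw [Measure.map_id, charFun_gaussianReal]
    push_cast
    ring_nf
  simp only [ProbabilityMeasure.coe_mk, hgauss]
  refine hlimit.congr fun n => ?_
  rw [charFun_apply_real, integral_map (hmeas n) (by fun_prop)]
  congr with ω
  rw [expSum]
  push_cast
  ring_nf

end CharacteristicFunction

end StronglyMixingSequences

section Variance

variable {Ω : Type*} {mΩ : MeasurableSpace Ω} {P : Measure Ω} [IsProbabilityMeasure P]
  {𝓜 : ℕ → MeasurableSpace Ω} {a : ℕ → ℝ}

lemma IsBoundedCentred.integral_sq_sum_range {Z : ℕ → Ω → ℝ} (hM : IsStronglyMixing P 𝓜 a)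
    (hZ : IsBoundedCentred P 𝓜 Z) (N : ℕ) :
    ∫ ω, (∑ d ∈ Finset.range N, Z d ω) ^ 2 ∂P
      = ∑ d ∈ Finset.range N, ∫ ω, Z d ω ^ 2 ∂P
        + 2 * ∑ k ∈ Finset.range N, ∑ d ∈ Finset.range (N - (k + 1)),
          ∫ ω, Z d ω * Z (d + (k + 1)) ω ∂P := by
  induction N with
  | zero => simp
  | succ N ih =>
    have hdiag : ∑ k ∈ Finset.range (N + 1), ∑ d ∈ Finset.range (N + 1 - (k + 1)),
          ∫ ω, Z d ω * Z (d + (k + 1)) ω ∂P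
        = ∑ k ∈ Finset.range N, ∑ d ∈ Finset.range (N - (k + 1)),
            ∫ ω, Z d ω * Z (d + (k + 1)) ω ∂P + ∑ j ∈ Finset.range N, ∫ ω, Z j ω * Z N ω ∂P := by
      rw [Finset.sum_range_succ, Nat.sub_self, Finset.range_zero, Finset.sum_empty, add_zero,
        ← Finset.sum_range_reflect (fun j => ∫ ω, Z j ω * Z N ω ∂P), ← Finset.sum_add_distrib]
      refine Finset.sum_congr rfl fun k hk => ?_
      have hkN := Finset.mem_range.1 hk
      rw [show N + 1 - (k + 1) = N - (k + 1) + 1 by omega, Finset.sum_range_succ,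
        show N - (k + 1) + (k + 1) = N by omega, Nat.sub_right_comm, Nat.sub_sub]
    rw [hdiag, Finset.sum_range_succ]
    simp_rw [sq (Z _ _)] at ih ⊢
    linear_combination ih + hZ.integral_sq_sum_range_succ_sub hM N

theorem tendsto_integral_sq_sum_div (hM : IsStronglyMixing P 𝓜 a) (ha : Summable a)
    {Z : ℕ → ℕ → Ω → ℝ} (hZ : ∀ n, IsBoundedCentred P 𝓜 (Z n)) {N : ℕ → ℕ} {b : ℕ → ℝ}
    (hN : ∀ n, N n ≤ b n) {v : ℝ} {c : ℕ → ℝ}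
    (hv : Tendsto (fun n => (∑ d ∈ Finset.range (N n), ∫ ω, Z n d ω ^ 2 ∂P) / b n) atTop (𝓝 v))
    (hc : ∀ k, Tendsto (fun n => (∑ d ∈ Finset.range (N n - (k + 1)),
      ∫ ω, Z n d ω * Z n (d + (k + 1)) ω ∂P) / b n) atTop (𝓝 (c k))) :
    Tendsto (fun n => (∫ ω, (∑ d ∈ Finset.range (N n), Z n d ω) ^ 2 ∂P) / b n) atTop
      (𝓝 (v + 2 * ∑' k, c k)) := by
  have hbound : ∀ n k, ‖(∑ d ∈ Finset.range (N n - (k + 1)),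
      ∫ ω, Z n d ω * Z n (d + (k + 1)) ω ∂P) / b n‖ ≤ 4 * a k := fun n k => by
    have hb : 0 ≤ b n := (Nat.cast_nonneg _).trans (hN n)
    rw [Real.norm_eq_abs, abs_div, abs_of_nonneg hb]
    refine div_le_of_le_mul₀ hb (mul_nonneg zero_le_four (hM.nonneg k)) ?_
    calc _ ≤ ∑ d ∈ Finset.range (N n - (k + 1)), |∫ ω, Z n d ω * Z n (d + (k + 1)) ω ∂P| :=
          Finset.abs_sum_le_sum_abs _ _
      _ ≤ ∑ d ∈ Finset.range (N n - (k + 1)), 4 * a k :=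
          Finset.sum_le_sum fun d _ => (hZ n).abs_integral_mul_le hM d k
      _ = (N n - (k + 1) : ℕ) * (4 * a k) := by simp
      _ ≤ b n * (4 * a k) := by
          have := hM.nonneg k
          gcongr
          exact (Nat.cast_le.2 (Nat.sub_le _ _)).trans (hN n)
      _ = 4 * a k * b n := mul_comm _ _
  have htsum := tendsto_tsum_of_dominated_convergence (ha.mul_left 4) hc
    (Eventually.of_forall hbound)
  refine (hv.add (htsum.const_mul 2)).congr fun n => ?_
  rw [(hZ n).integral_sq_sum_range hM, tsum_eq_sum (s := Finset.range (N n)) fun k hk => ?_]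
  · rw [← Finset.sum_div]
    ring
  · rw [Finset.mem_range, not_lt] at hk
    rw [Nat.sub_eq_zero_of_le (by omega), Finset.range_zero, Finset.sum_empty, zero_div]

end Variance

section ProductMixing

variable {Ω Ω' : Type*} {𝓐 𝓑 mΩ : MeasurableSpace Ω} {𝓐' 𝓑' mΩ' : MeasurableSpace Ω'}
  {P : Measure Ω} {P' : Measure Ω'} [IsProbabilityMeasure P] [IsProbabilityMeasure P'] {a : ℝ}

lemma prod_le_prod (h : 𝓐 ≤ 𝓑) (h' : 𝓐' ≤ 𝓑') : 𝓐.prod 𝓐' ≤ 𝓑.prod 𝓑' :=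
  sup_le_sup (MeasurableSpace.comap_mono h) (MeasurableSpace.comap_mono h')

lemma stronglyMeasurable_real_prodMk_right (h𝓐 : 𝓐 ≤ mΩ) {A : Set (Ω × Ω')}
    (hA : MeasurableSet[𝓐.prod 𝓐'] A) :
    StronglyMeasurable[𝓐'] fun ω' => P.real ((·, ω') ⁻¹' A) := by
  have htrim : ∀ ω', (P.trim h𝓐).real ((·, ω') ⁻¹' A) = P.real ((·, ω') ⁻¹' A) := fun ω' =>
    congrArg ENNReal.toReal (trim_measurableSet_eq h𝓐
      (@measurable_prodMk_right Ω Ω' 𝓐 𝓐' ω' _ hA))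
  simp_rw [← htrim]
  exact (@measurable_measure_prodMk_right Ω Ω' 𝓐 𝓐' (P.trim h𝓐) _ A
    hA).ennreal_toReal.stronglyMeasurable

lemma integral_real_prodMk_right {A : Set (Ω × Ω')} (hA : MeasurableSet A) :
    ∫ ω', P.real ((·, ω') ⁻¹' A) ∂P' = (P.prod P').real A := by
  rw [measureReal_def, Measure.prod_apply_symm hA]
  exact integral_toReal (measurable_measure_prodMk_right hA).aemeasurable
    (.of_forall fun _ => measure_lt_top _ _)

lemma AlphaBound.prod (h : AlphaBound P 𝓐 𝓑 a) (h𝓐 : 𝓐 ≤ mΩ) (h𝓑 : 𝓑 ≤ mΩ) (h𝓐' : 𝓐' ≤ mΩ')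
    (h𝓑' : 𝓑' ≤ mΩ') (hindep : Indep 𝓐' 𝓑' P') :
    AlphaBound (P.prod P') (𝓐.prod 𝓐') (𝓑.prod 𝓑') a := by
  intro A B hA hB
  have hA' := prod_le_prod h𝓐 h𝓐' _ hA
  have hB' := prod_le_prod h𝓑 h𝓑' _ hB
  have hAm := stronglyMeasurable_real_prodMk_right (P := P) h𝓐 hA
  have hBm := stronglyMeasurable_real_prodMk_right (P := P) h𝓑 hB
  have hbdd : ∀ C : Set (Ω × Ω'), ∀ ω', ‖P.real ((·, ω') ⁻¹' C)‖ ≤ 1 := fun C ω' => by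
    rw [Real.norm_of_nonneg measureReal_nonneg]
    exact measureReal_le_one
  have hprod : ∫ ω', P.real ((·, ω') ⁻¹' A) * P.real ((·, ω') ⁻¹' B) ∂P'
      = (P.prod P').real A * (P.prod P').real B := by
    rw [← integral_real_prodMk_right hA', ← integral_real_prodMk_right hB']
    refine IndepFun.integral_fun_mul_eq_mul_integral ?_ (hAm.mono h𝓐').aestronglyMeasurable
      (hBm.mono h𝓑').aestronglyMeasurable
    exact indep_of_indep_of_le_left (indep_of_indep_of_le_right hindep
      hBm.measurable.comap_le) hAm.measurable.comap_le
  have hinter : Integrable (fun ω' => P.real ((·, ω') ⁻¹' (A ∩ B))) P' :=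
    .of_bound ((stronglyMeasurable_real_prodMk_right le_rfl
      (hA'.inter hB')).aestronglyMeasurable) 1 (Eventually.of_forall (hbdd _))
  have hmul : Integrable (fun ω' => P.real ((·, ω') ⁻¹' A) * P.real ((·, ω') ⁻¹' B)) P' :=
    .of_bound ((hAm.mono h𝓐').mul (hBm.mono h𝓑')).aestronglyMeasurable 1
      (Eventually.of_forall fun ω' => by
        rw [norm_mul]
        exact mul_le_one₀ (hbdd A ω') (norm_nonneg _) (hbdd B ω'))
  rw [← hprod, ← integral_real_prodMk_right (hA'.inter hB'), ← integral_sub hinter hmul]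
  have hbound : ∀ ω', ‖P.real ((·, ω') ⁻¹' (A ∩ B))
      - P.real ((·, ω') ⁻¹' A) * P.real ((·, ω') ⁻¹' B)‖ ≤ a := fun ω' =>
    h (@measurable_prodMk_right Ω Ω' 𝓐 𝓐' ω' _ hA) (@measurable_prodMk_right Ω Ω' 𝓑 𝓑' ω' _ hB)
  simpa using norm_integral_le_of_norm_le_const (μ := P') (Eventually.of_forall hbound)

lemma IsStronglyMixing.prod {𝓜 : ℕ → MeasurableSpace Ω} {𝓜' : ℕ → MeasurableSpace Ω'} {a : ℕ → ℝ}
    (hM : IsStronglyMixing P 𝓜 a) (hM' : ∀ d, 𝓜' d ≤ mΩ') (hindep : iIndep 𝓜' P') :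
    IsStronglyMixing (P.prod P') (fun d => (𝓜 d).prod (𝓜' d)) a where
  le d := prod_le_prod (hM.le d) (hM' d)
  alphaBound k n := by
    have hle : ∀ T : Set ℕ, ⨆ d ∈ T, (𝓜 d).prod (𝓜' d) ≤ (⨆ d ∈ T, 𝓜 d).prod (⨆ d ∈ T, 𝓜' d) :=
      fun T => iSup₂_le fun d hd => prod_le_prod (le_iSup₂ (f := fun d _ => 𝓜 d) d hd)
        (le_iSup₂ (f := fun d _ => 𝓜' d) d hd)
    have hdisj : Disjoint (Set.Iic k) (Set.Ici (k + n + 1)) :=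
      Set.disjoint_left.2 fun d hd hd' => by
        rw [Set.mem_Iic] at hd
        rw [Set.mem_Ici] at hd'
        omega
    exact ((hM.alphaBound k n).prod (iSup₂_le fun d _ => hM.le d) (iSup₂_le fun d _ => hM.le d)
      (iSup₂_le fun d _ => hM' d) (iSup₂_le fun d _ => hM' d)
      (indep_iSup_of_disjoint hM' hindep hdisj)).mono (hle _) (hle _)

end ProductMixing

section Coins

variable {Ω : Type*} {mΩ : MeasurableSpace Ω}

/-- The coins: independent uniform random variables, one for every time. -/
abbrev coinLaw : Measure (ℕ → I) := Measure.infinitePi fun _ => volume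

/-- The `σ`-algebra of the coin of time `d`. -/
abbrev coinAlgebra (d : ℕ) : MeasurableSpace (ℕ → I) :=
  MeasurableSpace.comap (fun u => u d) inferInstance

/-- The result at time `d` when the probability of success is `Y d`, as a function of the point
`ω` on which `Y` depends and of the coins `u`: the indicator of `u d ≤ Y d ω`. -/
def toss (Y : ℕ → Ω → I) (d : ℕ) (z : Ω × (ℕ → I)) : ℝ :=
  if z.2 d ≤ Y d z.1 then 1 else 0

variable {P : Measure Ω} [IsProbabilityMeasure P] {Y : ℕ → Ω → I}

lemma measurable_toss {𝓐 : MeasurableSpace Ω} {d : ℕ} (hY : Measurable[𝓐] (Y d)) :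
    Measurable[𝓐.prod (coinAlgebra d)] (toss Y d) := by
  have hu : Measurable[𝓐.prod (coinAlgebra d)] fun z : Ω × (ℕ → I) => z.2 d :=
    (comap_measurable _).comp (@measurable_snd Ω (ℕ → I) 𝓐 (coinAlgebra d))
  have hY' : Measurable[𝓐.prod (coinAlgebra d)] fun z : Ω × (ℕ → I) => Y d z.1 :=
    hY.comp (@measurable_fst Ω (ℕ → I) 𝓐 (coinAlgebra d))
  exact Measurable.ite (measurableSet_le hu hY') measurable_const measurable_const

lemma integral_ite_le {E : Type*} [NormedAddCommGroup E] [NormedSpace ℝ E] [CompleteSpace E]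
    (x : I) (a b : E) :
    ∫ u : I, (if u ≤ x then a else b) = (x : ℝ) • a + (1 - x : ℝ) • b := by
  classical
  have h : (fun u : I => if u ≤ x then a else b)
      = (Set.Iic x).piecewise (fun _ => a) (fun _ => b) := rfl
  rw [h, integral_piecewise measurableSet_Iic (integrable_const _).integrableOn
    (integrable_const _).integrableOn, setIntegral_const, setIntegral_const, Set.compl_Iic,
    measureReal_def, measureReal_def, unitInterval.volume_Iic, unitInterval.volume_Ioi,
    ENNReal.toReal_ofReal x.2.1, ENNReal.toReal_ofReal (sub_nonneg.2 x.2.2)]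

lemma toss_eq_zero_or_one (Y : ℕ → Ω → I) (d : ℕ) (z : Ω × (ℕ → I)) :
    toss Y d z = 0 ∨ toss Y d z = 1 :=
  (ite_eq_or_eq (z.2 d ≤ Y d z.1) 1 0).symm

lemma integrable_prod_toss {𝕜 : Type*} [RCLike 𝕜] (hY : ∀ d, Measurable (Y d)) (h : ℕ → ℝ → 𝕜)
    (s : Finset ℕ) : Integrable (fun z => ∏ d ∈ s, h d (toss Y d z)) (P.prod coinLaw) := by
  have hh : ∀ d z, h d (toss Y d z) = h d 0 + (toss Y d z : 𝕜) * (h d 1 - h d 0) := fun d z => by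
    rcases toss_eq_zero_or_one Y d z with h0 | h1
    · simp [h0]
    · simp [h1]
  have hmeas : ∀ d, Measurable (toss Y d) := fun d =>
    (measurable_toss (hY d)).mono (prod_le_prod le_rfl (measurable_pi_apply d).comap_le) le_rfl
  refine .of_bound (Measurable.aestronglyMeasurable (Finset.measurable_prod _ fun d _ => ?_))
    (∏ d ∈ s, (‖h d 0‖ + ‖h d 1‖)) (Eventually.of_forall fun z => ?_)
  · simp_rw [hh]
    exact measurable_const.add ((RCLike.measurable_ofReal.comp (hmeas d)).mul_const _)
  · rw [norm_prod]
    refine Finset.prod_le_prod (fun _ _ => norm_nonneg _) fun d _ => ?_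
    rcases toss_eq_zero_or_one Y d z with h0 | h1
    · simp [h0]
    · simp [h1]

lemma integral_prod_toss {𝕜 : Type*} [RCLike 𝕜] (hY : ∀ d, Measurable (Y d)) (h : ℕ → ℝ → 𝕜)
    (s : Finset ℕ) :
    ∫ z, ∏ d ∈ s, h d (toss Y d z) ∂(P.prod coinLaw)
      = ∫ ω, ∏ d ∈ s, ((Y d ω : ℝ) • h d 1 + (1 - Y d ω : ℝ) • h d 0) ∂P := by
  rw [integral_prod _ (integrable_prod_toss hY h s)]
  congr with ω
  have hindep : iIndepFun (fun (d : s) (u : ℕ → I) => u d) coinLaw :=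
    (iIndepFun_infinitePi fun _ => measurable_id).precomp Subtype.val_injective
  have hstep : ∀ d, Measurable fun u : I => h d (if u ≤ Y d ω then 1 else 0) := fun d => by
    simp only [apply_ite (h d)]
    exact Measurable.ite measurableSet_Iic measurable_const measurable_const
  have hint : ∀ d, ∫ u : ℕ → I, h d (if u d ≤ Y d ω then 1 else 0) ∂coinLaw
      = (Y d ω : ℝ) • h d 1 + (1 - Y d ω : ℝ) • h d 0 := fun d => by
    rw [← integral_ite_le]
    simp only [← apply_ite (h d)]
    conv_rhs => rw [← Measure.infinitePi_map_eval (fun _ : ℕ => (volume : Measure I)) d]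
    rw [integral_map (measurable_pi_apply d).aemeasurable (hstep d).aestronglyMeasurable]
  calc ∫ u, ∏ d ∈ s, h d (toss Y d (ω, u)) ∂coinLaw
      = ∫ u, ∏ d : s, h d (if u d ≤ Y d ω then 1 else 0) ∂coinLaw := by
        congr with u
        exact (Finset.prod_coe_sort s fun d => h d (toss Y d (ω, u))).symm
    _ = ∏ d : s, ∫ u, h d (if u d ≤ Y d ω then 1 else 0) ∂coinLaw :=
        hindep.integral_fun_prod_comp (f := fun (d : s) x => h d (if x ≤ Y d ω then 1 else 0))
          (fun d => (measurable_pi_apply _).aemeasurable)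
          fun d => (hstep d).aestronglyMeasurable
    _ = ∏ d ∈ s, ((Y d ω : ℝ) • h d 1 + (1 - Y d ω : ℝ) • h d 0) := by
        simp_rw [hint]
        exact Finset.prod_coe_sort s fun d => (Y d ω : ℝ) • h d 1 + (1 - Y d ω : ℝ) • h d 0

lemma integral_toss (hY : ∀ d, Measurable (Y d)) (d : ℕ) :
    ∫ z, toss Y d z ∂(P.prod coinLaw) = ∫ ω, (Y d ω : ℝ) ∂P := by
  simpa using integral_prod_toss (P := P) hY (fun _ x => x) {d}

lemma integral_toss_sub_mul_toss_sub (hY : ∀ d, Measurable (Y d)) (m : ℕ → ℝ) {d e : ℕ}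
    (hde : d ≠ e) :
    ∫ z, (toss Y d z - m d) * (toss Y e z - m e) ∂(P.prod coinLaw)
      = ∫ ω, ((Y d ω : ℝ) - m d) * ((Y e ω : ℝ) - m e) ∂P := by
  have h := integral_prod_toss (P := P) hY (fun d x => x - m d) {d, e}
  simp_rw [Finset.prod_pair hde] at h
  rw [h]
  congr with ω
  simp only [smul_eq_mul]
  ring

lemma integral_toss_sub_sq (hY : ∀ d, Measurable (Y d)) (m : ℕ → ℝ) (d : ℕ) :
    ∫ z, (toss Y d z - m d) ^ 2 ∂(P.prod coinLaw)
      = ∫ ω, ((Y d ω : ℝ) - m d) ^ 2 ∂P + ∫ ω, ((Y d ω : ℝ) - (Y d ω : ℝ) ^ 2) ∂P := by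
  have hint : ∀ g : I → ℝ, Continuous g → Integrable (fun ω => g (Y d ω)) P := fun g hg => by
    obtain ⟨c, hc⟩ := isCompact_univ.exists_bound_of_continuousOn hg.continuousOn
    exact .of_bound (hg.measurable.comp (hY d)).aestronglyMeasurable c
      (Eventually.of_forall fun ω => hc _ (Set.mem_univ _))
  have h := integral_prod_toss (P := P) hY (fun d x => (x - m d) ^ 2) {d}
  simp_rw [Finset.prod_singleton] at h
  rw [h, ← integral_add (hint (fun x => ((x : ℝ) - m d) ^ 2) (by fun_prop))
    (hint (fun x => (x : ℝ) - (x : ℝ) ^ 2) (by fun_prop))]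
  congr with ω
  simp only [smul_eq_mul]
  ring

end Coins

section CentredCoins

variable {Ω : Type*} {mΩ : MeasurableSpace Ω} {P : Measure Ω} [IsProbabilityMeasure P]
  {𝓜 : ℕ → MeasurableSpace Ω} {a : ℕ → ℝ} {Y : ℕ → Ω → I}

lemma iIndep_coinAlgebra : iIndep coinAlgebra coinLaw :=
  iIndepFun_infinitePi (P := fun _ : ℕ => (volume : Measure I)) fun _ => measurable_id

lemma IsStronglyMixing.prod_coinLaw (hM : IsStronglyMixing P 𝓜 a) :
    IsStronglyMixing (P.prod coinLaw) (fun d => (𝓜 d).prod (coinAlgebra d)) a :=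
  hM.prod (fun d => (measurable_pi_apply d).comap_le) iIndep_coinAlgebra

lemma isBoundedCentred_toss (hM : IsStronglyMixing P 𝓜 a) (hY : ∀ d, Measurable[𝓜 d] (Y d)) :
    IsBoundedCentred (P.prod coinLaw) (fun d => (𝓜 d).prod (coinAlgebra d))
      fun d z => toss Y d z - ∫ ω, (Y d ω : ℝ) ∂P where
  stronglyMeasurable d := ((measurable_toss (hY d)).sub_const _).stronglyMeasurable
  abs_le_one d z := by
    have h0 : 0 ≤ ∫ ω, (Y d ω : ℝ) ∂P := integral_nonneg fun ω => (Y d ω).2.1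
    have h1 : ∫ ω, (Y d ω : ℝ) ∂P ≤ 1 :=
      (integral_mono_of_nonneg (.of_forall fun ω => (Y d ω).2.1) (integrable_const 1)
        (.of_forall fun ω => (Y d ω).2.2)).trans_eq (by simp)
    rcases toss_eq_zero_or_one Y d z with h | h <;> rw [h, abs_le] <;> constructor <;> linarith
  integral_eq_zero d := by
    have hY' : ∀ d, Measurable (Y d) := fun d => (hY d).mono (hM.le d) le_rfl
    have hint : Integrable (toss Y d) (P.prod coinLaw) := by
      simpa using integrable_prod_toss (P := P) hY' (fun _ x => x) {d}
    rw [integral_sub hint (integrable_const _), integral_toss hY']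
    simp

end CentredCoins

section Constants

variable (f : WinFunction) {μ ν : Measure ℝ≥0} [IsProbabilityMeasure ν] (s : ℝ≥0)

lemma measurable_winFunction : Measurable fun z : ℝ≥0 × ℝ≥0 => (f z.1 z.2 : ℝ) :=
  measurable_subtype_coe.comp f.measurable

lemma integrable_winFunction {α : Type*} [MeasurableSpace α] {m : Measure α} [IsFiniteMeasure m]
    {x y : α → ℝ≥0} (hx : Measurable x) (hy : Measurable y) :
    Integrable (fun a => (f (x a) (y a) : ℝ)) m :=
  .of_bound ((measurable_winFunction f).comp (hx.prodMk hy)).aestronglyMeasurable 1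
    (Eventually.of_forall fun a => by
      rw [Real.norm_of_nonneg (unitInterval.nonneg _)]
      exact unitInterval.le_one _)

lemma measurable_F : Measurable fun z : ℝ≥0 × ℝ≥0 => F f ν s z.1 z.2 := by
  have h : Measurable fun z : (ℝ≥0 × ℝ≥0) × ℝ≥0 => (f (s * z.1.1) (z.1.2 * z.2) : ℝ) :=
    (measurable_winFunction f).comp (by fun_prop : Measurable fun z : (ℝ≥0 × ℝ≥0) × ℝ≥0 =>
      (s * z.1.1, z.1.2 * z.2))
  exact h.stronglyMeasurable.integral_prod_right.measurable

lemma F_mem_unitInterval (x y : ℝ≥0) : F f ν s x y ∈ I :=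
  ⟨integral_nonneg fun _ => unitInterval.nonneg _,
    (integral_mono (integrable_winFunction f measurable_const (by fun_prop)) (integrable_const 1)
      fun _ => unitInterval.le_one _).trans_eq (by simp)⟩

lemma integrable_F {α : Type*} [MeasurableSpace α] {m : Measure α} [IsFiniteMeasure m]
    {x y : α → ℝ≥0} (hx : Measurable x) (hy : Measurable y) :
    Integrable (fun a => F f ν s (x a) (y a)) m :=
  .of_bound ((measurable_F f s).comp (hx.prodMk hy)).aestronglyMeasurable 1
    (Eventually.of_forall fun a => by
      rw [Real.norm_of_nonneg (F_mem_unitInterval f s _ _).1]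
      exact (F_mem_unitInterval f s _ _).2)

lemma measurable_Ftilde : Measurable fun z : ℝ≥0 × ℝ≥0 => Ftilde f ν s z.1 z.2 :=
  (measurable_F f s).sub ((measurable_F f s).stronglyMeasurable.integral_prod_left'.measurable.comp
    measurable_snd)

lemma measurable_Ftilde_left (y : ℝ≥0) : Measurable fun x => Ftilde f ν s x y :=
  (measurable_Ftilde f s).comp measurable_prodMk_right

lemma abs_Ftilde_le_one (x y : ℝ≥0) : |Ftilde f ν s x y| ≤ 1 := by
  have hF := F_mem_unitInterval f (ν := ν) s x y
  have h0 : 0 ≤ ∫ v, F f ν s v y ∂ν := integral_nonneg fun v => (F_mem_unitInterval f s v y).1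
  have h1 : ∫ v, F f ν s v y ∂ν ≤ 1 :=
    (integral_mono (integrable_F f s measurable_id measurable_const) (integrable_const 1)
      fun v => (F_mem_unitInterval f s v y).2).trans_eq (by simp)
  rw [Ftilde, abs_le]
  constructor <;> linarith [hF.1, hF.2]

lemma integral_Ftilde (y : ℝ≥0) : ∫ v, Ftilde f ν s v y ∂ν = 0 := by
  have hF : Integrable (fun v => F f ν s v y) ν := integrable_F f s measurable_id measurable_const
  simp_rw [Ftilde]
  rw [integral_sub hF (integrable_const _)]
  simp

lemma F_sub_sq_mem_unitInterval (x y : ℝ≥0) : F f ν s x y - F f ν s x y ^ 2 ∈ I := by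
  obtain ⟨h0, h1⟩ := F_mem_unitInterval f (ν := ν) s x y
  constructor <;> nlinarith

lemma sigmaSq_nonneg : 0 ≤ sigmaSq f μ ν s :=
  integral_nonneg fun _ => (F_sub_sq_mem_unitInterval f s _ _).1

lemma ell_eq_integral_F [IsProbabilityMeasure μ] :
    ell f μ ν s = ∫ z, F f ν s z.1 z.2 ∂(ν.prod μ) := by
  rw [ell, integral_prod _ (integrable_F f s measurable_fst measurable_snd),
    integral_prod _ (integrable_winFunction f (by fun_prop) (by fun_prop))]
  congr with x
  exact integral_prod_symm (μ := ν) (ν := μ)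
    (fun z : ℝ≥0 × ℝ≥0 => (f (s * x) (z.2 * z.1) : ℝ))
    (integrable_winFunction f (by fun_prop) (by fun_prop))

lemma sigmaSq_eq_ell_sub [IsProbabilityMeasure μ] :
    sigmaSq f μ ν s = ell f μ ν s - ∫ z, F f ν s z.1 z.2 ^ 2 ∂(ν.prod μ) := by
  have hF : Integrable (fun z : ℝ≥0 × ℝ≥0 => F f ν s z.1 z.2) (ν.prod μ) :=
    integrable_F f s measurable_fst measurable_snd
  have hsq : Integrable (fun z : ℝ≥0 × ℝ≥0 => F f ν s z.1 z.2 ^ 2) (ν.prod μ) :=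
    hF.mono' ((measurable_F f s).pow_const 2).aestronglyMeasurable
      (Eventually.of_forall fun z => by
        obtain ⟨h0, h1⟩ := F_mem_unitInterval f (ν := ν) s z.1 z.2
        rw [Real.norm_of_nonneg (sq_nonneg _)]
        exact pow_le_of_le_one h0 h1 two_ne_zero)
  rw [sigmaSq, ell_eq_integral_F, integral_sub hF hsq]

end Constants

section DailyFactors

variable {Ω : Type*} [mΩ : MeasurableSpace Ω] {P : Measure Ω} {ξ : ℕ → Ω → ℝ≥0}
  {μ ν : Measure ℝ≥0}

lemma IsPairStationary.integral_comp (hstat : IsPairStationary P ξ ν)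
    (hξ : ∀ ℓ, Measurable (ξ ℓ)) {g : ℝ≥0 → ℝ} (hg : Measurable g) (d : ℕ) :
    ∫ ω, g (ξ d ω) ∂P = ∫ v, g v ∂ν := by
  rw [← hstat.map_eq d, integral_map (hξ d).aemeasurable hg.aestronglyMeasurable]

/-- `E[F̃_s(ξ_1, y) F̃_s(ξ_{1+k}, y')]`, the covariance of the conditional centred results on two
days at distance `k` against opponents of initial strengths `y` and `y'`. -/
def covFtilde (f : WinFunction) (ν : Measure ℝ≥0) (P : Measure Ω) (ξ : ℕ → Ω → ℝ≥0) (s : ℝ≥0)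
    (k : ℕ) (y y' : ℝ≥0) : ℝ :=
  ∫ ω, Ftilde f ν s (ξ 0 ω) y * Ftilde f ν s (ξ k ω) y' ∂P

variable (f : WinFunction) [IsProbabilityMeasure ν] (s : ℝ≥0)

lemma integral_Ftilde_mul_Ftilde (hξ : ∀ ℓ, Measurable (ξ ℓ)) (hstat : IsPairStationary P ξ ν)
    (d k : ℕ) (y y' : ℝ≥0) :
    ∫ ω, Ftilde f ν s (ξ d ω) y * Ftilde f ν s (ξ (d + k) ω) y' ∂P
      = covFtilde f ν P ξ s k y y' := by
  have hg : Measurable fun z : ℝ≥0 × ℝ≥0 => Ftilde f ν s z.1 y * Ftilde f ν s z.2 y' :=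
    ((measurable_Ftilde f s).comp (measurable_fst.prodMk measurable_const)).mul
      ((measurable_Ftilde f s).comp (measurable_snd.prodMk measurable_const))
  have hint : ∀ i j, ∫ ω, Ftilde f ν s (ξ i ω) y * Ftilde f ν s (ξ j ω) y' ∂P
      = ∫ z, Ftilde f ν s z.1 y * Ftilde f ν s z.2 y' ∂(P.map fun ω => (ξ i ω, ξ j ω)) :=
    fun i j => (integral_map ((hξ i).prodMk (hξ j)).aemeasurable hg.aestronglyMeasurable).symm
  rw [covFtilde, hint, hint, hstat.map_pair_eq 0 k d, zero_add, add_comm k d]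

lemma isBoundedCentred_Ftilde (hξ : ∀ ℓ, Measurable (ξ ℓ)) (hstat : IsPairStationary P ξ ν)
    (y : ℕ → ℝ≥0) :
    IsBoundedCentred P (fun d => MeasurableSpace.comap (ξ d) inferInstance)
      fun d ω => Ftilde f ν s (ξ d ω) (y d) where
  stronglyMeasurable d :=
    ((measurable_Ftilde_left f s (y d)).comp (comap_measurable (ξ d))).stronglyMeasurable
  abs_le_one d ω := abs_Ftilde_le_one f s _ _
  integral_eq_zero d := by
    rw [hstat.integral_comp hξ (measurable_Ftilde_left f s (y d)), integral_Ftilde]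

variable [IsProbabilityMeasure P] [IsProbabilityMeasure μ]

lemma abs_measureReal_inter_sub_le_one (A B : Set Ω) :
    |P.real (A ∩ B) - P.real A * P.real B| ≤ 1 := by
  have hmul : P.real A * P.real B ≤ 1 :=
    mul_le_one₀ measureReal_le_one measureReal_nonneg measureReal_le_one
  have hmul0 : 0 ≤ P.real A * P.real B := by positivity
  have hinter : P.real (A ∩ B) ≤ 1 := measureReal_le_one
  have hinter0 : 0 ≤ P.real (A ∩ B) := measureReal_nonneg
  rw [abs_le]
  constructor <;> linarith

lemma isStronglyMixing_comap (hξ : ∀ ℓ, Measurable (ξ ℓ)) :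
    IsStronglyMixing P (fun d => MeasurableSpace.comap (ξ d) inferInstance)
      fun n => alpha P ξ (n + 1) where
  le d := (hξ d).comap_le
  alphaBound k n A B hA hB := by
    refine le_csSup ⟨1, ?_⟩ ⟨k, A, B, hA, hB, rfl⟩
    rintro _ ⟨k, A, B, -, -, rfl⟩
    exact abs_measureReal_inter_sub_le_one A B

lemma measurable_Ftilde_mul_Ftilde (hξ : ∀ ℓ, Measurable (ξ ℓ)) (k : ℕ) :
    Measurable fun z : Ω × ℝ≥0 × ℝ≥0 =>
      Ftilde f ν s (ξ 0 z.1) z.2.1 * Ftilde f ν s (ξ k z.1) z.2.2 :=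
  ((measurable_Ftilde f s).comp (((hξ 0).comp measurable_fst).prodMk measurable_snd.fst)).mul
    ((measurable_Ftilde f s).comp (((hξ k).comp measurable_fst).prodMk measurable_snd.snd))

lemma measurable_covFtilde (hξ : ∀ ℓ, Measurable (ξ ℓ)) (k : ℕ) :
    Measurable fun z : ℝ≥0 × ℝ≥0 => covFtilde f ν P ξ s k z.1 z.2 :=
  (measurable_Ftilde_mul_Ftilde f s hξ k).stronglyMeasurable.integral_prod_left'.measurable

lemma abs_Ftilde_mul_Ftilde_le_one (x y x' y' : ℝ≥0) :
    |Ftilde f ν s x y * Ftilde f ν s x' y'| ≤ 1 := by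
  rw [abs_mul]
  exact mul_le_one₀ (abs_Ftilde_le_one f s _ _) (abs_nonneg _) (abs_Ftilde_le_one f s _ _)

lemma covTerm_eq_integral_covFtilde (hξ : ∀ ℓ, Measurable (ξ ℓ)) (k : ℕ) :
    covTerm f μ ν P ξ s k = ∫ z, covFtilde f ν P ξ s k z.1 z.2 ∂(μ.prod μ) :=
  integral_prod_symm _ (.of_bound (measurable_Ftilde_mul_Ftilde f s hξ k).aestronglyMeasurable 1
    (Eventually.of_forall fun _ => abs_Ftilde_mul_Ftilde_le_one f s _ _ _ _))

lemma abs_covFtilde_le_one (k : ℕ) (y y' : ℝ≥0) : |covFtilde f ν P ξ s k y y'| ≤ 1 := by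
  have hle : ∀ ω, ‖Ftilde f ν s (ξ 0 ω) y * Ftilde f ν s (ξ k ω) y'‖ ≤ 1 := fun ω =>
    abs_Ftilde_mul_Ftilde_le_one f s _ _ _ _
  simpa [covFtilde] using norm_integral_le_of_norm_le_const (μ := P) (Eventually.of_forall hle)

lemma abs_covFtilde_le_alpha (hξ : ∀ ℓ, Measurable (ξ ℓ)) (hstat : IsPairStationary P ξ ν) (k : ℕ)
    (y y' : ℝ≥0) : |covFtilde f ν P ξ s (k + 1) y y'| ≤ 4 * alpha P ξ (k + 1) := by
  simpa [covFtilde] using (isBoundedCentred_Ftilde f s hξ hstat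
    (fun d => if d = 0 then y else y')).abs_integral_mul_le (isStronglyMixing_comap hξ) 0 k

lemma summable_covTerm (hξ : ∀ ℓ, Measurable (ξ ℓ)) (hstat : IsPairStationary P ξ ν)
    (hα : Summable fun n => alpha P ξ (n + 1)) :
    Summable fun k => covTerm f μ ν P ξ s (k + 1) := by
  refine .of_norm_bounded (hα.mul_left 4) fun k => ?_
  have hle : ∀ z : ℝ≥0 × ℝ≥0, ‖covFtilde f ν P ξ s (k + 1) z.1 z.2‖ ≤ 4 * alpha P ξ (k + 1) :=
    fun z => abs_covFtilde_le_alpha f s hξ hstat k z.1 z.2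
  rw [covTerm_eq_integral_covFtilde f s hξ]
  simpa using norm_integral_le_of_norm_le_const (μ := μ.prod μ) (Eventually.of_forall hle)

end DailyFactors

section StrongLaw

variable {Ω : Type*} [mΩ : MeasurableSpace Ω] {Q : Measure Ω}

lemma hasSubgaussianMGF_mono {X : Ω → ℝ} {c c' : ℝ≥0} (h : HasSubgaussianMGF X c Q)
    (hc : c ≤ c') : HasSubgaussianMGF X c' Q where
  integrable_exp_mul := h.integrable_exp_mul
  mgf_le t := (h.mgf_le t).trans (Real.exp_le_exp.2 (by gcongr))

variable [IsProbabilityMeasure Q]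

lemma ae_eventually_lt_of_hasSubgaussianMGF {X : ℕ → Ω → ℝ} {c : ℝ≥0} (hc : 0 < c)
    (h : ∀ n, HasSubgaussianMGF (X n) (c * n) Q) {ε : ℝ} (hε : 0 < ε) :
    ∀ᵐ ω ∂Q, ∀ᶠ n : ℕ in atTop, X n ω < ε * n := by
  have htail : ∀ n : ℕ, Q {ω | ε * n ≤ X n ω}
      ≤ ENNReal.ofReal (Real.exp (-ε ^ 2 / (2 * c)) ^ n) := by
    intro n
    rw [← ofReal_measureReal]
    refine ENNReal.ofReal_le_ofReal (((h n).measure_ge_le (by positivity)).trans_eq ?_)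
    rw [← Real.exp_nat_mul]
    congr 1
    rcases eq_or_ne n 0 with rfl | hn
    · simp
    · push_cast
      field_simp
  have hsummable : Summable fun n : ℕ => Real.exp (-ε ^ 2 / (2 * c)) ^ n :=
    summable_geometric_of_lt_one (Real.exp_pos _).le
      (Real.exp_lt_one_iff.2
        (div_neg_of_neg_of_pos (neg_neg_of_pos (pow_pos hε 2)) (by positivity)))
  have hfinite : ∑' n : ℕ, Q {ω | ε * n ≤ X n ω} ≠ ⊤ :=
    ((ENNReal.tsum_le_tsum htail).trans_lt hsummable.tsum_ofReal_lt_top).ne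
  filter_upwards [ae_eventually_notMem hfinite] with ω hω
  filter_upwards [hω] with n hn
  exact not_le.1 hn

lemma ae_tendsto_div_of_hasSubgaussianMGF {X : ℕ → Ω → ℝ} {c : ℝ≥0} (hc : 0 < c)
    (h : ∀ n, HasSubgaussianMGF (X n) (c * n) Q) :
    ∀ᵐ ω ∂Q, Tendsto (fun n : ℕ => X n ω / n) atTop (𝓝 0) := by
  have habove : ∀ᵐ ω ∂Q, ∀ m : ℕ, ∀ᶠ n : ℕ in atTop, X n ω < 1 / ((m : ℝ) + 1) * n :=
    ae_all_iff.2 fun m => ae_eventually_lt_of_hasSubgaussianMGF hc h Nat.one_div_pos_of_nat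
  have hbelow : ∀ᵐ ω ∂Q, ∀ m : ℕ, ∀ᶠ n : ℕ in atTop, -X n ω < 1 / ((m : ℝ) + 1) * n :=
    ae_all_iff.2 fun m => ae_eventually_lt_of_hasSubgaussianMGF hc (fun n => (h n).neg)
      Nat.one_div_pos_of_nat
  filter_upwards [habove, hbelow] with ω habove hbelow
  rw [Metric.tendsto_nhds]
  intro ε hε
  obtain ⟨m, hm⟩ := exists_nat_one_div_lt hε
  filter_upwards [habove m, hbelow m, eventually_gt_atTop 0] with n hlt hgt hn
  have hn' : (0 : ℝ) < n := by positivity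
  rw [dist_zero_right, Real.norm_eq_abs, abs_div, abs_of_pos hn', div_lt_iff₀ hn', abs_lt]
  have := mul_lt_mul_of_pos_right hm hn'
  constructor <;> linarith

section Blocks

variable {ι κ : Type*} {𝓜 : ι → MeasurableSpace Ω} {T : κ → Set ι} {X : κ → Ω → ℝ}

lemma hasSubgaussianMGF_sum_of_pairwiseDisjoint (hle : ∀ i, 𝓜 i ≤ mΩ) (hind : iIndep 𝓜 Q)
    (hX : ∀ d, Measurable[⨆ i ∈ T d, 𝓜 i] (X d)) (hb : ∀ d ω, |X d ω| ≤ 1) {D : Finset κ}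
    (hD : (D : Set κ).PairwiseDisjoint T) :
    HasSubgaussianMGF (fun ω => ∑ d ∈ D, (X d ω - ∫ ω', X d ω' ∂Q)) D.card Q := by
  classical
  induction D using Finset.induction_on with
  | empty => simp
  | insert i D hi ih =>
    rw [Finset.coe_insert, Set.pairwiseDisjoint_insert_of_notMem (by simpa using hi)] at hD
    have hXi : HasSubgaussianMGF (fun ω => X i ω - ∫ ω', X i ω' ∂Q) 1 Q := by
      convert hasSubgaussianMGF_of_mem_Icc (μ := Q) (a := -1) (b := 1)
        ((hX i).mono (iSup₂_le fun j _ => hle j) le_rfl).aemeasurable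
        (Eventually.of_forall fun ω => abs_le.1 (hb i ω)) using 1
      norm_num [← NNReal.coe_inj]
    have hsum : Measurable[⨆ j ∈ ⋃ d ∈ D, T d, 𝓜 j]
        fun ω => ∑ d ∈ D, (X d ω - ∫ ω', X d ω' ∂Q) :=
      Finset.measurable_sum _ fun d hd => ((hX d).mono
        (biSup_mono fun j hj => Set.mem_biUnion hd hj) le_rfl).sub_const _
    have hdisj : Disjoint (T i) (⋃ d ∈ D, T d) :=
      Set.disjoint_iUnion₂_right.2 fun d hd => hD.2 d hd
    have hindep : IndepFun (fun ω => X i ω - ∫ ω', X i ω' ∂Q)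
        (fun ω => ∑ d ∈ D, (X d ω - ∫ ω', X d ω' ∂Q)) Q :=
      indep_of_indep_of_le_left (indep_of_indep_of_le_right
        (indep_iSup_of_disjoint hle hind hdisj) hsum.comap_le) ((hX i).sub_const _).comap_le
    simp_rw [Finset.sum_insert hi, Finset.card_insert_of_notMem hi, Nat.cast_add, Nat.cast_one,
      add_comm (D.card : ℝ≥0) 1]
    exact hXi.add_of_indepFun (ih hD.1) hindep

end Blocks

lemma ae_tendsto_sum_sub_integral_div {ι κ : Type*} {𝓜 : ι → MeasurableSpace Ω}
    (hle : ∀ i, 𝓜 i ≤ mΩ) (hind : iIndep 𝓜 Q) {T : ℕ → κ → Set ι} {X : ℕ → κ → Ω → ℝ}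
    (hX : ∀ n d, Measurable[⨆ i ∈ T n d, 𝓜 i] (X n d)) (hb : ∀ n d ω, |X n d ω| ≤ 1)
    {D : ℕ → Finset κ} (hD : ∀ n, (D n : Set κ).PairwiseDisjoint (T n))
    (hcard : ∀ n, (D n).card ≤ 2 * n) :
    ∀ᵐ ω ∂Q, Tendsto (fun n : ℕ => (∑ d ∈ D n, (X n d ω - ∫ ω', X n d ω' ∂Q)) / (2 * n)) atTop
      (𝓝 0) := by
  have hsub : ∀ n, HasSubgaussianMGF (fun ω => ∑ d ∈ D n, (X n d ω - ∫ ω', X n d ω' ∂Q))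
      (2 * n) Q := fun n => hasSubgaussianMGF_mono
    (hasSubgaussianMGF_sum_of_pairwiseDisjoint hle hind (hX n) (hb n) (hD n))
    (by exact_mod_cast hcard n)
  filter_upwards [ae_tendsto_div_of_hasSubgaussianMGF two_pos hsub] with ω hω
  simpa [mul_comm, div_div] using hω.div_const 2

lemma tendsto_two_mul_sub_div (k : ℕ) :
    Tendsto (fun n : ℕ => ((2 * n - k : ℕ) : ℝ) / (2 * n)) atTop (𝓝 1) := by
  have h : Tendsto (fun n : ℕ => 1 - (k : ℝ) / 2 * (1 / (n : ℝ))) atTop (𝓝 1) := by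
    simpa using (tendsto_one_div_atTop_nhds_zero_nat (𝕜 := ℝ)).const_mul
      ((k : ℝ) / 2) |>.const_sub 1
  refine h.congr' ?_
  filter_upwards [eventually_gt_atTop k] with n hn
  have hn0 : n ≠ 0 := by lia
  rw [Nat.cast_sub (by lia)]
  push_cast
  field_simp

end StrongLaw

section SampledAverages

variable {E : Type*} [MeasurableSpace E] {μ : Measure E} [IsProbabilityMeasure μ]

lemma iIndep_comap_eval_infinitePi :
    iIndep (fun i : ℕ => MeasurableSpace.comap (fun S : ℕ → E => S i) inferInstance)
      (Measure.infinitePi fun _ : ℕ => μ) :=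
  (iIndepFun_infinitePi (X := fun _ x => x) fun _ => measurable_id).iIndep

lemma measurable_comp_pair_iSup_comap_eval {h : E × E → ℝ} (hm : Measurable h) (a b : ℕ) :
    Measurable[⨆ i ∈ ({a, b} : Set ℕ), MeasurableSpace.comap (fun S : ℕ → E => S i) inferInstance]
      fun S => h (S a, S b) := by
  have heval : ∀ i ∈ ({a, b} : Set ℕ), Measurable[⨆ i ∈ ({a, b} : Set ℕ),
      MeasurableSpace.comap (fun S : ℕ → E => S i) inferInstance] fun S : ℕ → E => S i :=
    fun i hi => (comap_measurable _).mono
      (le_biSup (fun i => MeasurableSpace.comap (fun S : ℕ → E => S i) inferInstance) hi) le_rfl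
  exact hm.comp ((heval a (by simp)).prodMk (heval b (by simp)))

lemma integral_infinitePi_eval {g : E → ℝ} (hg : Measurable g) (i : ℕ) :
    ∫ S, g (S i) ∂(Measure.infinitePi fun _ : ℕ => μ) = ∫ y, g y ∂μ := by
  rw [← integral_map (φ := fun S : ℕ → E => S i) (measurable_pi_apply i).aemeasurable
    hg.aestronglyMeasurable]
  exact congrArg (fun m => ∫ y, g y ∂m) (Measure.infinitePi_map_eval (fun _ : ℕ => μ) i)

lemma integral_infinitePi_pair {h : E × E → ℝ} (hm : Measurable h) {i j : ℕ} (hij : i ≠ j) :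
    ∫ S, h (S i, S j) ∂(Measure.infinitePi fun _ : ℕ => μ) = ∫ z, h z ∂(μ.prod μ) := by
  rw [← Measure.infinitePi_map_eval_prod (P := fun _ : ℕ => μ) hij,
    integral_map (Measurable.aemeasurable (by fun_prop)) hm.aestronglyMeasurable]

variable {o : ℕ → ℕ → ℕ} (ho : ∀ n, Set.InjOn (o n) (Set.Iio (2 * n - 1)))

include ho

lemma ae_tendsto_average {g : E → ℝ} (hg : Measurable g) (hb : ∀ y, |g y| ≤ 1) :
    ∀ᵐ S ∂(Measure.infinitePi fun _ : ℕ => μ),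
      Tendsto (fun n : ℕ => (∑ d ∈ Finset.range (2 * n - 1), g (S (o n d))) / (2 * n)) atTop
        (𝓝 (∫ y, g y ∂μ)) := by
  have hdisj : ∀ n, (Finset.range (2 * n - 1) : Set ℕ).PairwiseDisjoint
      fun d => ({o n d, o n d} : Set ℕ) := fun n d hd d' hd' hne => by
    simpa [Function.onFun] using (ho n).ne (by simpa using hd) (by simpa using hd') hne
  filter_upwards [ae_tendsto_sum_sub_integral_div (fun i => (measurable_pi_apply i).comap_le)
    (iIndep_comap_eval_infinitePi (μ := μ))
    (fun n d => measurable_comp_pair_iSup_comap_eval (hg.comp measurable_fst) (o n d) (o n d))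
    (fun n d S => hb _) hdisj fun n => by simp] with S hS
  have hlim := hS.add ((tendsto_two_mul_sub_div 1).mul_const (∫ y, g y ∂μ))
  rw [zero_add, one_mul] at hlim
  refine hlim.congr fun n => ?_
  simp only [Function.comp_apply, integral_infinitePi_eval hg, Finset.sum_sub_distrib,
    Finset.sum_const, Finset.card_range, nsmul_eq_mul]
  ring

lemma pairwiseDisjoint_pair {k : ℕ} (hk : 0 < k) (n r : ℕ) :
    (({d ∈ Finset.range (2 * n - 1 - k) | d / k % 2 = r} : Finset ℕ) : Set ℕ).PairwiseDisjoint
      fun d => ({o n d, o n (d + k)} : Set ℕ) := by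
  intro d hd d' hd' hne
  rw [Finset.mem_coe, Finset.mem_filter, Finset.mem_range] at hd hd'
  have hdk : (d + k) / k = d / k + 1 := Nat.add_div_right d hk
  have hdk' : (d' + k) / k = d' / k + 1 := Nat.add_div_right d' hk
  have hne₁ : d ≠ d' + k := by rintro rfl; lia
  have hne₂ : d + k ≠ d' := by rintro rfl; lia
  have hinj : ∀ {i j}, i < 2 * n - 1 → j < 2 * n - 1 → i ≠ j → o n i ≠ o n j :=
    fun hi hj => (ho n).ne hi hj
  simp only [Function.onFun, Set.disjoint_insert_left, Set.disjoint_singleton_left,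
    Set.mem_insert_iff, Set.mem_singleton_iff, not_or]
  exact ⟨⟨hinj (by lia) (by lia) hne, hinj (by lia) (by lia) hne₁⟩,
    hinj (by lia) (by lia) hne₂, hinj (by lia) (by lia) (by lia)⟩

lemma ae_tendsto_pair_average {h : E × E → ℝ} (hm : Measurable h) (hb : ∀ z, |h z| ≤ 1) {k : ℕ}
    (hk : 0 < k) :
    ∀ᵐ S ∂(Measure.infinitePi fun _ : ℕ => μ),
      Tendsto (fun n : ℕ => (∑ d ∈ Finset.range (2 * n - 1 - k), h (S (o n d), S (o n (d + k))))
        / (2 * n)) atTop (𝓝 (∫ z, h z ∂(μ.prod μ))) := by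
  -- Pairs at distance `k` overlap, but those with `⌊d / k⌋` of a given parity are disjoint, hence
  -- independent.
  have hclass : ∀ r : ℕ, ∀ᵐ S ∂(Measure.infinitePi fun _ : ℕ => μ), Tendsto (fun n : ℕ =>
      (∑ d ∈ Finset.range (2 * n - 1 - k) with d / k % 2 = r,
        (h (S (o n d), S (o n (d + k))) - ∫ z, h z ∂(μ.prod μ))) / (2 * n)) atTop (𝓝 0) := by
    intro r
    filter_upwards [ae_tendsto_sum_sub_integral_div (fun i => (measurable_pi_apply i).comap_le)
      (iIndep_comap_eval_infinitePi (μ := μ))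
      (fun n d => measurable_comp_pair_iSup_comap_eval hm (o n d) (o n (d + k)))
      (fun n d S => hb _) (fun n => pairwiseDisjoint_pair ho hk n r)
      fun n => (Finset.card_filter_le _ _).trans (by simp only [Finset.card_range]; lia)] with S hS
    refine hS.congr fun n => ?_
    congr 1
    refine Finset.sum_congr rfl fun d hd => ?_
    have hd' := Finset.mem_range.1 (Finset.mem_filter.1 hd).1
    have hne : o n d ≠ o n (d + k) :=
      (ho n).ne (by simp only [Set.mem_Iio]; lia) (by simp only [Set.mem_Iio]; lia) (by lia)
    rw [integral_infinitePi_pair hm hne]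
  filter_upwards [hclass 0, hclass 1] with S heven hodd
  have hlim := (heven.add hodd).add
    ((tendsto_two_mul_sub_div (1 + k)).mul_const (∫ z, h z ∂(μ.prod μ)))
  rw [zero_add, zero_add, one_mul] at hlim
  refine hlim.congr fun n => ?_
  have hodd_iff : ∀ d, d / k % 2 = 1 ↔ ¬ d / k % 2 = 0 := fun d => by lia
  simp_rw [hodd_iff]
  rw [← add_div, Finset.sum_filter_add_sum_filter_not, Finset.sum_sub_distrib, Finset.sum_const,
    Finset.card_range, nsmul_eq_mul, Nat.sub_sub]
  ring

end SampledAverages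

section Variances

variable {Ω : Type*} [mΩ : MeasurableSpace Ω] {P : Measure Ω} {ξ : ℕ → Ω → ℝ≥0}
  {μ ν : Measure ℝ≥0} [IsProbabilityMeasure μ] [IsProbabilityMeasure ν]

lemma ae_tendsto_integral_average (hξ : ∀ ℓ, Measurable (ξ ℓ)) (hstat : IsPairStationary P ξ ν)
    {o : ℕ → ℕ → ℕ} (ho : ∀ n, Set.InjOn (o n) (Set.Iio (2 * n - 1))) {φ : ℝ≥0 × ℝ≥0 → ℝ}
    (hφ : Measurable φ) (hb : ∀ z, |φ z| ≤ 1) :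
    ∀ᵐ S ∂(Measure.infinitePi fun _ : ℕ => μ),
      Tendsto (fun n : ℕ => (∑ d ∈ Finset.range (2 * n - 1), ∫ ω, φ (ξ d ω, S (o n d)) ∂P)
        / (2 * n)) atTop (𝓝 (∫ z, φ z ∂(ν.prod μ))) := by
  have hbound : ∀ y, |∫ v, φ (v, y) ∂ν| ≤ 1 := fun y => by
    have hle : ∀ v, ‖φ (v, y)‖ ≤ 1 := fun v => hb _
    simpa using norm_integral_le_of_norm_le_const (μ := ν) (Eventually.of_forall hle)
  rw [integral_prod_symm φ (.of_bound hφ.aestronglyMeasurable 1 (Eventually.of_forall hb))]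
  filter_upwards [ae_tendsto_average (μ := μ) ho
    hφ.stronglyMeasurable.integral_prod_left'.measurable hbound] with S hS
  refine hS.congr fun n => congrArg (· / _) (Finset.sum_congr rfl fun d _ => ?_)
  exact (hstat.integral_comp hξ (hφ.comp measurable_prodMk_right) d).symm

variable (f : WinFunction) (s : ℝ≥0)

lemma ae_tendsto_Ftilde_sq_average (hξ : ∀ ℓ, Measurable (ξ ℓ)) (hstat : IsPairStationary P ξ ν)
    {o : ℕ → ℕ → ℕ} (ho : ∀ n, Set.InjOn (o n) (Set.Iio (2 * n - 1))) :
    ∀ᵐ S ∂(Measure.infinitePi fun _ : ℕ => μ),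
      Tendsto (fun n : ℕ => (∑ d ∈ Finset.range (2 * n - 1),
        ∫ ω, Ftilde f ν s (ξ d ω) (S (o n d)) ^ 2 ∂P) / (2 * n)) atTop
        (𝓝 (∫ z, Ftilde f ν s z.1 z.2 ^ 2 ∂(ν.prod μ))) :=
  ae_tendsto_integral_average hξ hstat ho ((measurable_Ftilde f s).pow_const 2) fun z => by
    rw [abs_pow]
    exact pow_le_one₀ (abs_nonneg _) (abs_Ftilde_le_one f s _ _)

lemma ae_tendsto_F_sub_sq_average (hξ : ∀ ℓ, Measurable (ξ ℓ)) (hstat : IsPairStationary P ξ ν)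
    {o : ℕ → ℕ → ℕ} (ho : ∀ n, Set.InjOn (o n) (Set.Iio (2 * n - 1))) :
    ∀ᵐ S ∂(Measure.infinitePi fun _ : ℕ => μ),
      Tendsto (fun n : ℕ => (∑ d ∈ Finset.range (2 * n - 1),
        ∫ ω, (F f ν s (ξ d ω) (S (o n d)) - F f ν s (ξ d ω) (S (o n d)) ^ 2) ∂P) / (2 * n)) atTop
        (𝓝 (sigmaSq f μ ν s)) :=
  ae_tendsto_integral_average hξ hstat ho ((measurable_F f s).sub ((measurable_F f s).pow_const 2))
    fun z => (abs_of_nonneg (F_sub_sq_mem_unitInterval f s z.1 z.2).1).trans_le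
      (F_sub_sq_mem_unitInterval f s z.1 z.2).2

variable [IsProbabilityMeasure P]

lemma ae_tendsto_covariance_average (hξ : ∀ ℓ, Measurable (ξ ℓ)) (hstat : IsPairStationary P ξ ν)
    {o : ℕ → ℕ → ℕ} (ho : ∀ n, Set.InjOn (o n) (Set.Iio (2 * n - 1))) (k : ℕ) :
    ∀ᵐ S ∂(Measure.infinitePi fun _ : ℕ => μ),
      Tendsto (fun n : ℕ => (∑ d ∈ Finset.range (2 * n - 1 - (k + 1)),
        ∫ ω, Ftilde f ν s (ξ d ω) (S (o n d))
          * Ftilde f ν s (ξ (d + (k + 1)) ω) (S (o n (d + (k + 1)))) ∂P) / (2 * n)) atTop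
        (𝓝 (covTerm f μ ν P ξ s (k + 1))) := by
  simp_rw [integral_Ftilde_mul_Ftilde f s hξ hstat, covTerm_eq_integral_covFtilde f s hξ]
  exact ae_tendsto_pair_average ho (measurable_covFtilde f s hξ (k + 1))
    (fun z => abs_covFtilde_le_one f s _ _ _) k.succ_pos

lemma rhoSq_nonneg (hξ : ∀ ℓ, Measurable (ξ ℓ)) (hstat : IsPairStationary P ξ ν)
    (hα : Summable fun n => alpha P ξ (n + 1)) : 0 ≤ rhoSq f μ ν P ξ s := by
  have ho : ∀ n : ℕ, Set.InjOn (id : ℕ → ℕ) (Set.Iio (2 * n - 1)) := fun n => Set.injOn_id _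
  obtain ⟨S, hsq, hcov⟩ := ((ae_tendsto_Ftilde_sq_average (μ := μ) f s hξ hstat ho).and
    (ae_all_iff.2 (ae_tendsto_covariance_average (μ := μ) f s hξ hstat ho))).exists
  refine ge_of_tendsto' (tendsto_integral_sq_sum_div (isStronglyMixing_comap hξ) hα
    (Z := fun _ d ω => Ftilde f ν s (ξ d ω) (S d)) (N := fun n => 2 * n - 1)
    (fun _ => isBoundedCentred_Ftilde f s hξ hstat S) (b := fun n => 2 * n) (fun n => ?_) hsq hcov)
    fun _ => by positivity
  exact_mod_cast (Nat.sub_le _ _ : 2 * n - 1 ≤ 2 * n)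

end Variances

section WinChance

variable {Ω : Type*} {ξ : ℕ → Ω → ℝ≥0} {μ ν : Measure ℝ≥0} [IsProbabilityMeasure ν]
  (f : WinFunction) (s : ℝ≥0)

/-- The conditional probabilities, given the path `ξ` of `T_0`, that it wins its successive matches
against opponents of initial strengths `y`: the numbers `F_s(ξ_d, y_d)`, as elements of `[0,1]`. -/
def winChance (f : WinFunction) (ν : Measure ℝ≥0) [IsProbabilityMeasure ν] (s : ℝ≥0)
    (ξ : ℕ → Ω → ℝ≥0) (y : ℕ → ℝ≥0) (d : ℕ) (ω : Ω) : I :=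
  ⟨F f ν s (ξ d ω) (y d), F_mem_unitInterval f s _ _⟩

lemma measurable_winChance (y : ℕ → ℝ≥0) (d : ℕ) :
    Measurable[MeasurableSpace.comap (ξ d) inferInstance] (winChance f ν s ξ y d) :=
  (((measurable_F f s).comp measurable_prodMk_right).comp (comap_measurable (ξ d))).subtype_mk

variable [mΩ : MeasurableSpace Ω] {P : Measure Ω}

lemma winChance_sub_integral (hξ : ∀ ℓ, Measurable (ξ ℓ)) (hstat : IsPairStationary P ξ ν)
    (y : ℕ → ℝ≥0) (d : ℕ) (ω : Ω) :
    (winChance f ν s ξ y d ω : ℝ) - ∫ ω', (winChance f ν s ξ y d ω' : ℝ) ∂P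
      = Ftilde f ν s (ξ d ω) (y d) := by
  congr 1
  exact hstat.integral_comp hξ ((measurable_F f s).comp measurable_prodMk_right) d

variable [IsProbabilityMeasure P]

/-- The centred sequence of results of `T_0`: success on day `d` has probability
`winChance f ν s ξ y d` given `ξ`. -/
def centredResult (f : WinFunction) (ν : Measure ℝ≥0) [IsProbabilityMeasure ν] (P : Measure Ω)
    (s : ℝ≥0) (ξ : ℕ → Ω → ℝ≥0) (y : ℕ → ℝ≥0) (d : ℕ) (z : Ω × (ℕ → I)) : ℝ :=
  toss (winChance f ν s ξ y) d z - ∫ ω, (winChance f ν s ξ y d ω : ℝ) ∂P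

lemma integral_centredResult_sq (hξ : ∀ ℓ, Measurable (ξ ℓ)) (hstat : IsPairStationary P ξ ν)
    (y : ℕ → ℝ≥0) (d : ℕ) :
    ∫ z, centredResult f ν P s ξ y d z ^ 2 ∂(P.prod coinLaw)
      = ∫ ω, Ftilde f ν s (ξ d ω) (y d) ^ 2 ∂P
        + ∫ ω, (F f ν s (ξ d ω) (y d) - F f ν s (ξ d ω) (y d) ^ 2) ∂P := by
  have h := integral_toss_sub_sq (P := P)
    (fun d => (measurable_winChance f (ν := ν) s y d).mono (hξ d).comap_le le_rfl)
    (fun d => ∫ ω, (winChance f ν s ξ y d ω : ℝ) ∂P) d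
  simp_rw [winChance_sub_integral f s hξ hstat] at h
  exact h

lemma integral_centredResult_mul (hξ : ∀ ℓ, Measurable (ξ ℓ)) (hstat : IsPairStationary P ξ ν)
    (y : ℕ → ℝ≥0) {d e : ℕ} (hde : d ≠ e) :
    ∫ z, centredResult f ν P s ξ y d z * centredResult f ν P s ξ y e z ∂(P.prod coinLaw)
      = ∫ ω, Ftilde f ν s (ξ d ω) (y d) * Ftilde f ν s (ξ e ω) (y e) ∂P := by
  have h := integral_toss_sub_mul_toss_sub (P := P)
    (fun d => (measurable_winChance f (ν := ν) s y d).mono (hξ d).comap_le le_rfl)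
    (fun d => ∫ ω, (winChance f ν s ξ y d ω : ℝ) ∂P) hde
  simp_rw [winChance_sub_integral f s hξ hstat] at h
  exact h

variable [IsProbabilityMeasure μ]

lemma ae_tendsto_integral_sq_sum_centredResult (hξ : ∀ ℓ, Measurable (ξ ℓ))
    (hstat : IsPairStationary P ξ ν) (hα : Summable fun n => alpha P ξ (n + 1))
    {o : ℕ → ℕ → ℕ} (ho : ∀ n, Set.InjOn (o n) (Set.Iio (2 * n - 1))) :
    ∀ᵐ S ∂(Measure.infinitePi fun _ : ℕ => μ), Tendsto (fun n : ℕ =>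
      (∫ z, (∑ d ∈ Finset.range (2 * n - 1), centredResult f ν P s ξ (fun d => S (o n d)) d z) ^ 2
        ∂(P.prod coinLaw)) / (2 * n)) atTop (𝓝 (sigmaSq f μ ν s + rhoSq f μ ν P ξ s)) := by
  filter_upwards [ae_tendsto_Ftilde_sq_average (μ := μ) f s hξ hstat ho,
    ae_tendsto_F_sub_sq_average (μ := μ) f s hξ hstat ho,
    ae_all_iff.2 (ae_tendsto_covariance_average (μ := μ) f s hξ hstat ho)] with S hsq hcoin hcov
  rw [rhoSq, ← add_assoc, add_comm (sigmaSq f μ ν s)]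
  refine tendsto_integral_sq_sum_div (isStronglyMixing_comap hξ).prod_coinLaw hα
    (fun n => isBoundedCentred_toss (isStronglyMixing_comap hξ) (measurable_winChance f s _))
    (fun n => by exact_mod_cast (Nat.sub_le _ _ : 2 * n - 1 ≤ 2 * n)) ?_ fun k => ?_
  · refine (hsq.add hcoin).congr fun n => ?_
    rw [← add_div, ← Finset.sum_add_distrib]
    exact congrArg (· / _) (Finset.sum_congr rfl fun d _ =>
      (integral_centredResult_sq f s hξ hstat (fun d => S (o n d)) d).symm)
  · exact (hcov k).congr fun n => congrArg (· / _) (Finset.sum_congr rfl fun d _ =>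
      (integral_centredResult_mul f s hξ hstat (fun d => S (o n d)) (by lia)).symm)

theorem ae_tendstoInDistribution_sum_centredResult (hξ : ∀ ℓ, Measurable (ξ ℓ))
    (hstat : IsPairStationary P ξ ν) (hα : Summable fun n => alpha P ξ (n + 1))
    {o : ℕ → ℕ → ℕ} (ho : ∀ n, Set.InjOn (o n) (Set.Iio (2 * n - 1))) :
    ∀ᵐ S ∂(Measure.infinitePi fun _ : ℕ => μ), TendstoInDistribution (fun (n : ℕ) z =>
      (∑ d ∈ Finset.range (2 * n - 1), centredResult f ν P s ξ (fun d => S (o n d)) d z)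
        / √(2 * (n : ℝ))) atTop (id : ℝ → ℝ) (fun _ => P.prod coinLaw)
      (gaussianReal 0 (Real.toNNReal (sigmaSq f μ ν s + rhoSq f μ ν P ξ s))) := by
  filter_upwards [ae_tendsto_integral_sq_sum_centredResult (μ := μ) f s hξ hstat hα ho] with S hS
  have hv : 0 ≤ sigmaSq f μ ν s + rhoSq f μ ν P ξ s :=
    add_nonneg (sigmaSq_nonneg f s) (rhoSq_nonneg f s hξ hstat hα)
  rw [← Real.coe_toNNReal _ hv] at hS
  exact tendstoInDistribution_sum_div_sqrt (isStronglyMixing_comap hξ).prod_coinLaw hα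
    (fun n => isBoundedCentred_toss (isStronglyMixing_comap hξ) (measurable_winChance f s _))
    (tendsto_natCast_atTop_atTop.const_mul_atTop two_pos)
    (fun n => by exact_mod_cast (Nat.sub_le _ _ : 2 * n - 1 ≤ 2 * n)) hS

end WinChance

section Calendar

variable {N : ℕ}

namespace Calendar

variable (C : Calendar N)

/-- The day on which `T_0` plays against `T_{j+1}`. -/
def opponentDay (j : Fin N) : ℕ := C.day 0 j.succ

lemma opponentDay_injective : Function.Injective C.opponentDay := fun i j hij =>
  Fin.succ_injective _ ((C.bijOn 0).injOn (Fin.succ_ne_zero i) (Fin.succ_ne_zero j) hij)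

lemma opponentDay_lt (j : Fin N) : C.opponentDay j < N :=
  (C.bijOn 0).mapsTo (Fin.succ_ne_zero j)

lemma exists_opponentDay_eq {d : ℕ} (hd : d < N) : ∃ j, C.opponentDay j = d := by
  obtain ⟨i, hi, hid⟩ := (C.bijOn 0).surjOn hd
  obtain ⟨j, rfl⟩ := Fin.exists_succ_eq.2 hi
  exact ⟨j, hid⟩

open Classical in
/-- The index `j` such that `T_0` plays against `T_{j+1}` on day `d`; the junk value `0` if there
is no match on day `d`. -/
def opponent (d : ℕ) : ℕ :=
  if h : ∃ j, C.opponentDay j = d then h.choose else 0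

lemma opponent_opponentDay (j : Fin N) : C.opponent (C.opponentDay j) = j := by
  have h : ∃ i, C.opponentDay i = C.opponentDay j := ⟨j, rfl⟩
  rw [opponent, dif_pos h, C.opponentDay_injective h.choose_spec]

lemma injOn_opponent : Set.InjOn C.opponent (Set.Iio N) := by
  intro d hd d' hd' h
  obtain ⟨j, rfl⟩ := C.exists_opponentDay_eq hd
  obtain ⟨j', rfl⟩ := C.exists_opponentDay_eq hd'
  rw [opponent_opponentDay, opponent_opponentDay] at h
  rw [Fin.ext h]

lemma prod_opponentDay {M : Type*} [CommMonoid M] (g : ℕ → ℕ → M) :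
    ∏ j : Fin N, g (C.opponentDay j) j = ∏ d ∈ Finset.range N, g d (C.opponent d) := by
  refine Finset.prod_bij (fun j _ => C.opponentDay j)
    (fun j _ => Finset.mem_range.2 (C.opponentDay_lt j))
    (fun i _ j _ h => C.opponentDay_injective h) (fun d hd => ?_) fun j _ => ?_
  · obtain ⟨j, hj⟩ := C.exists_opponentDay_eq (Finset.mem_range.1 hd)
    exact ⟨j, Finset.mem_univ _, hj⟩
  · rw [opponent_opponentDay]

end Calendar

/-- The match of `T_0` against `T_{j+1}`. -/
def matchZero (j : Fin N) : Match N := ⟨(0, j.succ), j.succ_pos⟩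

lemma matchZero_injective : Function.Injective (matchZero (N := N)) := fun _ _ h =>
  Fin.succ_injective _ (congrArg (fun m : Match N => m.1.2) h)

lemma exists_matchZero_eq {m : Match N} (hm : m.1.1 = 0) : ∃ j, matchZero j = m := by
  obtain ⟨⟨_, i⟩, hlt⟩ := m
  obtain rfl : _ = 0 := hm
  obtain ⟨j, rfl⟩ := Fin.exists_succ_eq.2 (Fin.ne_zero_of_lt hlt)
  exact ⟨j, rfl⟩

lemma wins_eq_sum (r : Match N → Bool) :
    wins r = ∑ j : Fin N, if r (matchZero j) = true then 1 else 0 :=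
  Finset.card_filter _ _

end Calendar

section QuenchedLaw

lemma integral_smul_add_one_sub_smul {α E : Type*} [MeasurableSpace α] {m : Measure α}
    [IsProbabilityMeasure m] [NormedAddCommGroup E] [NormedSpace ℝ E] [CompleteSpace E]
    {w : α → ℝ} (hw : Integrable w m) (a b : E) :
    ∫ x, (w x • a + (1 - w x) • b) ∂m = (∫ x, w x ∂m) • a + (1 - ∫ x, w x ∂m) • b := by
  have hw' : Integrable (fun x => 1 - w x) m := (integrable_const 1).sub hw
  rw [integral_add (hw.smul_const a) (hw'.smul_const b), integral_smul_const, integral_smul_const,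
    integral_sub (integrable_const 1) hw]
  simp

lemma norm_smul_add_one_sub_smul_le {E : Type*} [SeminormedAddCommGroup E] [NormedSpace ℝ E]
    (x : I) (a b : E) : ‖(x : ℝ) • a + (1 - x : ℝ) • b‖ ≤ ‖a‖ + ‖b‖ := by
  refine (norm_add_le _ _).trans (add_le_add ?_ ?_)
  · rw [norm_smul, Real.norm_of_nonneg x.2.1]
    exact mul_le_of_le_one_left (norm_nonneg _) x.2.2
  · rw [norm_smul, Real.norm_of_nonneg (sub_nonneg.2 x.2.2)]
    exact mul_le_of_le_one_left (norm_nonneg _) (by linarith [x.2.1])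

variable {N : ℕ}

lemma integral_condResults_prod (f : WinFunction) (C : Calendar N) (x : Fin (N + 1) → ℝ≥0)
    (e : Fin (N + 1) → ℕ → ℝ≥0) (h : Bool → ℂ) :
    ∫ r, ∏ j, h (r (matchZero j)) ∂(condResults f C x e)
      = ∏ j, ((winProb f C x e (matchZero j) : ℝ) • h true
        + (1 - winProb f C x e (matchZero j) : ℝ) • h false) := by
  let H : Match N → Bool → ℂ := fun m b => if m.1.1 = 0 then h b else 1
  have hH : ∀ m ∉ Set.range (matchZero (N := N)), H m = 1 := fun m hm => by
    ext b
    exact if_neg fun h0 => hm (exists_matchZero_eq h0)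
  have hprod : ∀ r : Match N → Bool, ∏ j, h (r (matchZero j)) = ∏ m, H m (r m) := fun r =>
    Fintype.prod_of_injective matchZero matchZero_injective _ _
      (fun m hm => by rw [hH m hm, Pi.one_apply]) fun j => rfl
  simp_rw [hprod, condResults]
  rw [integral_fintype_prod_eq_prod]
  refine (Fintype.prod_of_injective matchZero matchZero_injective _ _ (fun m hm => ?_)
    fun j => ?_).symm
  · simp [hH m hm]
  · exact (integral_bernoulliMeasure _ _ _ _).symm

lemma integral_resultsLaw (f : WinFunction) (Q : ProbabilityMeasure (ℕ → ℝ≥0))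
    (C : Calendar N) (x : Fin (N + 1) → ℝ≥0) (g : (Match N → Bool) → ℂ) :
    ∫ r, g r ∂(resultsLaw f Q C x : Measure (Match N → Bool))
      = ∫ e, ∫ r, g r ∂(condResults f C x e)
        ∂(Measure.pi fun _ : Fin (N + 1) => (Q : Measure (ℕ → ℝ≥0))) := by
  let κ : Kernel (Fin (N + 1) → ℕ → ℝ≥0) (Match N → Bool) :=
    ⟨condResults f C x, measurable_condResults f C x⟩
  let m := Measure.pi fun _ : Fin (N + 1) => (Q : Measure (ℕ → ℝ≥0))
  have hm : (resultsLaw f Q C x : Measure (Match N → Bool)) = (κ ∘ₖ Kernel.const Unit m) () :=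
    Measure.comp_eq_comp_const_apply (κ := κ) (μ := m)
  have := (resultsLaw f Q C x).2
  rw [hm, Kernel.integral_comp (hm ▸ Integrable.of_finite), Kernel.const_apply]
  rfl

lemma integral_pi_prod_succ {X : Type*} [MeasurableSpace X] {Q : Measure X}
    [IsProbabilityMeasure Q] {φ : X → Fin N → X → ℂ} {B : Fin N → ℝ}
    (hφ : ∀ j, Measurable fun z : X × X => φ z.1 j z.2) (hB : ∀ x j y, ‖φ x j y‖ ≤ B j) :
    ∫ e, ∏ j : Fin N, φ (e 0) j (e j.succ) ∂(Measure.pi fun _ : Fin (N + 1) => Q)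
      = ∫ x, ∏ j : Fin N, ∫ y, φ x j y ∂Q ∂Q := by
  have hint : Integrable (fun z : X × (Fin N → X) => ∏ j, φ z.1 j (z.2 j))
      (Q.prod (Measure.pi fun _ => Q)) := by
    refine .of_bound (Measurable.aestronglyMeasurable (Finset.measurable_prod _ fun j _ =>
      (hφ j).comp (measurable_fst.prodMk ((measurable_pi_apply j).comp measurable_snd))))
      (∏ j, B j) (Eventually.of_forall fun z => ?_)
    rw [norm_prod]
    exact Finset.prod_le_prod (fun j _ => norm_nonneg _) fun j _ => hB _ _ _
  rw [← (measurePreserving_piFinSuccAbove (fun _ : Fin (N + 1) => Q) 0).symm.integral_comp']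
  simp only [MeasurableEquiv.piFinSuccAbove_symm_apply, Fin.insertNthEquiv_zero,
    Fin.consEquiv_apply, Fin.cons_zero, Fin.cons_succ]
  rw [integral_prod _ hint]
  simp_rw [integral_fintype_prod_eq_prod]

variable {Ω : Type*} [mΩ : MeasurableSpace Ω] {P : Measure Ω} [IsProbabilityMeasure P]
  {ξ : ℕ → Ω → ℝ≥0} {ν : Measure ℝ≥0}

lemma integral_pathLaw {E : Type*} [NormedAddCommGroup E] [NormedSpace ℝ E]
    (hξ : ∀ ℓ, Measurable (ξ ℓ)) {g : (ℕ → ℝ≥0) → E}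
    (hg : AEStronglyMeasurable g (pathLaw P ξ hξ : Measure (ℕ → ℝ≥0))) :
    ∫ e, g e ∂(pathLaw P ξ hξ : Measure (ℕ → ℝ≥0)) = ∫ ω, g (fun ℓ => ξ ℓ ω) ∂P :=
  integral_map (measurable_pi_lambda _ hξ).aemeasurable hg

lemma integral_winFunction_pathLaw (hξ : ∀ ℓ, Measurable (ξ ℓ)) (hstat : IsPairStationary P ξ ν)
    (f : WinFunction) (s x y : ℝ≥0) (d : ℕ) :
    ∫ e, (f (s * x) (y * e d) : ℝ) ∂(pathLaw P ξ hξ : Measure (ℕ → ℝ≥0)) = F f ν s x y := by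
  have hf : Measurable fun v : ℝ≥0 => (f (s * x) (y * v) : ℝ) :=
    (measurable_winFunction f).comp (by fun_prop : Measurable fun v : ℝ≥0 => (s * x, y * v))
  exact (integral_pathLaw hξ (hf.comp (measurable_pi_apply d)).aestronglyMeasurable).trans
    (hstat.integral_comp hξ hf d)

variable [IsProbabilityMeasure ν]

lemma integral_quenchedLaw_prod (hξ : ∀ ℓ, Measurable (ξ ℓ)) (hstat : IsPairStationary P ξ ν)
    (f : WinFunction) (C : Calendar N) (s : ℝ≥0) (S : ℕ → ℝ≥0) (h : Bool → ℂ) :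
    ∫ r, ∏ j, h (r (matchZero j)) ∂(quenchedLaw f (pathLaw P ξ hξ) C s S)
      = ∫ ω, ∏ d ∈ Finset.range N, (F f ν s (ξ d ω) (S (C.opponent d)) • h true
        + (1 - F f ν s (ξ d ω) (S (C.opponent d))) • h false) ∂P := by
  let w : (ℕ → ℝ≥0) → Fin N → (ℕ → ℝ≥0) → I := fun x j y =>
    f (s * x (C.opponentDay j)) (S j * y (C.opponentDay j))
  have hw : ∀ j, Measurable fun z : (ℕ → ℝ≥0) × (ℕ → ℝ≥0) => (w z.1 j z.2 : ℝ) := fun j =>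
    (measurable_winFunction f).comp (by fun_prop : Measurable fun z : (ℕ → ℝ≥0) × (ℕ → ℝ≥0) =>
      (s * z.1 (C.opponentDay j), S j * z.2 (C.opponentDay j)))
  have hopponent : ∀ x j, ∫ y, ((w x j y : ℝ) • h true + (1 - w x j y : ℝ) • h false)
      ∂(pathLaw P ξ hξ : Measure (ℕ → ℝ≥0)) = F f ν s (x (C.opponentDay j)) (S j) • h true
        + (1 - F f ν s (x (C.opponentDay j)) (S j)) • h false := fun x j => by
    rw [integral_smul_add_one_sub_smul (integrable_winFunction f (by fun_prop) (by fun_prop)),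
      integral_winFunction_pathLaw hξ hstat]
  have hF : Measurable fun x : ℕ → ℝ≥0 => ∏ j : Fin N,
      (F f ν s (x (C.opponentDay j)) (S j) • h true
        + (1 - F f ν s (x (C.opponentDay j)) (S j)) • h false) :=
    Finset.measurable_prod _ fun j _ => by
      have hFj : Measurable fun x : ℕ → ℝ≥0 => F f ν s (x (C.opponentDay j)) (S j) :=
        (measurable_F f s).comp (by fun_prop : Measurable fun x : ℕ → ℝ≥0 =>
          (x (C.opponentDay j), S j))
      fun_prop
  calc ∫ r, ∏ j, h (r (matchZero j)) ∂(quenchedLaw f (pathLaw P ξ hξ) C s S)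
      = ∫ e, ∏ j, ((w (e 0) j (e j.succ) : ℝ) • h true + (1 - w (e 0) j (e j.succ) : ℝ) • h false)
          ∂(Measure.pi fun _ : Fin (N + 1) => (pathLaw P ξ hξ : Measure (ℕ → ℝ≥0))) := by
        rw [quenchedLaw, integral_resultsLaw]
        simp_rw [integral_condResults_prod]
        rfl
    _ = ∫ x, ∏ j : Fin N, (F f ν s (x (C.opponentDay j)) (S j) • h true
          + (1 - F f ν s (x (C.opponentDay j)) (S j)) • h false)
          ∂(pathLaw P ξ hξ : Measure (ℕ → ℝ≥0)) := by
        simp_rw [← hopponent]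
        exact integral_pi_prod_succ (fun j => by have := hw j; fun_prop)
          fun x j y => norm_smul_add_one_sub_smul_le (w x j y) _ _
    _ = _ := by
        rw [integral_pathLaw hξ hF.aestronglyMeasurable]
        congr with ω
        exact C.prod_opponentDay fun d i => F f ν s (ξ d ω) (S i) • h true
          + (1 - F f ν s (ξ d ω) (S i)) • h false

theorem identDistrib_wins (hξ : ∀ ℓ, Measurable (ξ ℓ)) (hstat : IsPairStationary P ξ ν)
    (f : WinFunction) (C : Calendar N) (s : ℝ≥0) (S : ℕ → ℝ≥0) :
    IdentDistrib (fun r => (wins r : ℝ))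
      (fun z => ∑ d ∈ Finset.range N, toss (winChance f ν s ξ fun d => S (C.opponent d)) d z)
      (quenchedLaw f (pathLaw P ξ hξ) C s S) (P.prod coinLaw) := by
  have hY : ∀ d, Measurable (winChance f ν s ξ (fun d => S (C.opponent d)) d) := fun d =>
    (measurable_winChance f s _ d).mono (hξ d).comap_le le_rfl
  have htoss : Measurable fun z : Ω × (ℕ → I) =>
      ∑ d ∈ Finset.range N, toss (winChance f ν s ξ fun d => S (C.opponent d)) d z :=
    Finset.measurable_sum _ fun d _ => (measurable_toss (hY d)).mono
      (prod_le_prod le_rfl (measurable_pi_apply d).comap_le) le_rfl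
  have : IsProbabilityMeasure ((P.prod coinLaw).map fun z =>
      ∑ d ∈ Finset.range N, toss (winChance f ν s ξ fun d => S (C.opponent d)) d z) :=
    Measure.isProbabilityMeasure_map htoss.aemeasurable
  refine ⟨(measurable_of_finite _).aemeasurable, htoss.aemeasurable,
    Measure.ext_of_charFun (funext fun t => ?_)⟩
  rw [charFun_apply_real, charFun_apply_real,
    integral_map (measurable_of_finite _).aemeasurable (by fun_prop),
    integral_map htoss.aemeasurable (by fun_prop)]
  have hchar := integral_quenchedLaw_prod hξ hstat f C s S
    fun b => Complex.exp (t * (if b = true then 1 else 0 : ℝ) * Complex.I)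
  have htoss_char := integral_prod_toss (P := P) hY
    (fun _ x => Complex.exp (t * x * Complex.I)) (Finset.range N)
  simp only [← Complex.exp_sum, ← Finset.sum_mul, ← Finset.mul_sum, ← Complex.ofReal_sum]
    at hchar htoss_char
  simp only [wins_eq_sum, Nat.cast_sum, Nat.cast_ite, Nat.cast_one, Nat.cast_zero]
  exact hchar.trans htoss_char.symm

lemma identDistrib_normalizedWins (hξ : ∀ ℓ, Measurable (ξ ℓ)) (hstat : IsPairStationary P ξ ν)
    (f : WinFunction) (n : ℕ) (C : Calendar (2 * n - 1)) (s : ℝ≥0) (S : ℕ → ℝ≥0) :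
    IdentDistrib (normalizedWins n (quenchedLaw f (pathLaw P ξ hξ) C s S))
      (fun z => (∑ d ∈ Finset.range (2 * n - 1),
        centredResult f ν P s ξ (fun d => S (C.opponent d)) d z) / √(2 * (n : ℝ)))
      (quenchedLaw f (pathLaw P ξ hξ) C s S) (P.prod coinLaw) := by
  have hY : ∀ d, Measurable (winChance f ν s ξ (fun d => S (C.opponent d)) d) := fun d =>
    (measurable_winChance f s _ d).mono (hξ d).comap_le le_rfl
  have hwins := identDistrib_wins hξ hstat f C s S
  have hmean : ∫ r, (wins r : ℝ) ∂(quenchedLaw f (pathLaw P ξ hξ) C s S)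
      = ∑ d ∈ Finset.range (2 * n - 1),
        ∫ ω, (winChance f ν s ξ (fun d => S (C.opponent d)) d ω : ℝ) ∂P := by
    rw [hwins.integral_eq, integral_finsetSum _ fun d _ => by
      simpa using integrable_prod_toss (P := P) hY (fun _ x => x) {d}]
    exact Finset.sum_congr rfl fun d _ => integral_toss hY d
  simp only [centredResult, Finset.sum_sub_distrib, ← hmean]
  exact (hwins.sub_const _).div_const _

end QuenchedLaw

section ConvergenceInDistribution

variable {ι E Ω' : Type*} {Ω₁ Ω₂ : ι → Type*} [∀ i, MeasurableSpace (Ω₁ i)]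
  [∀ i, MeasurableSpace (Ω₂ i)] [MeasurableSpace Ω'] [TopologicalSpace E] [MeasurableSpace E]
  [OpensMeasurableSpace E] {m₁ : ∀ i, Measure (Ω₁ i)} {m₂ : ∀ i, Measure (Ω₂ i)} {m' : Measure Ω'}
  [∀ i, IsProbabilityMeasure (m₁ i)] [∀ i, IsProbabilityMeasure (m₂ i)] [IsProbabilityMeasure m']
  {X : ∀ i, Ω₁ i → E} {Y : ∀ i, Ω₂ i → E} {Z : Ω' → E} {l : Filter ι}

lemma tendstoInDistribution_of_identDistrib (hX : TendstoInDistribution X l Z m₁ m')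
    (h : ∀ i, IdentDistrib (Y i) (X i) (m₂ i) (m₁ i)) : TendstoInDistribution Y l Z m₂ m' where
  forall_aemeasurable i := (h i).aemeasurable_fst
  aemeasurable_limit := hX.aemeasurable_limit
  tendsto := by
    simp_rw [(h _).map_eq]
    exact hX.tendsto

end ConvergenceInDistribution

end League

end

theorem theorem2 {Ω : Type*} [MeasurableSpace Ω] (P : Measure Ω) [IsProbabilityMeasure P]
    (ξ : ℕ → Ω → ℝ≥0) (hξ : ∀ ℓ, Measurable (ξ ℓ))
    (μ ν : Measure ℝ≥0) [IsProbabilityMeasure μ] [IsProbabilityMeasure ν]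
    (hstat : League.IsPairStationary P ξ ν) (hweak : League.IsWeaklyMixing P ξ)
    (hmix : League.CLTMixing P ξ)
    (f : League.WinFunction)
    -- the calendar of the league with `2 n` teams, for every `n`
    (C : ∀ n : ℕ, League.Calendar (2 * n - 1))
    (s : ℝ≥0) :
    League.sigmaSq f μ ν s =
        League.ell f μ ν s - ∫ z, League.F f ν s z.1 z.2 ^ 2 ∂(ν.prod μ) ∧
      Summable (fun k : ℕ => League.covTerm f μ ν P ξ s (k + 1)) ∧
      0 ≤ League.sigmaSq f μ ν s ∧ 0 ≤ League.rhoSq f μ ν P ξ s ∧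
      ∀ᵐ S ∂(Measure.infinitePi fun _ : ℕ => μ),
        TendstoInDistribution
          (fun n => League.normalizedWins n
            (League.quenchedLaw f (League.pathLaw P ξ hξ) (C n) s S))
          atTop (id : ℝ → ℝ)
          (fun n => League.quenchedLaw f (League.pathLaw P ξ hξ) (C n) s S)
          (gaussianReal 0 (League.sigmaSq f μ ν s + League.rhoSq f μ ν P ξ s).toNNReal) := by
  have hα := hmix.summable_alpha
  refine ⟨League.sigmaSq_eq_ell_sub f s, League.summable_covTerm f s hξ hstat hα,
    League.sigmaSq_nonneg f s, League.rhoSq_nonneg f s hξ hstat hα, ?_⟩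
  filter_upwards [League.ae_tendstoInDistribution_sum_centredResult (μ := μ) f s hξ hstat hα
    fun n => (C n).injOn_opponent] with S hS
  exact League.tendstoInDistribution_of_identDistrib hS fun n =>
    League.identDistrib_normalizedWins hξ hstat f n (C n) s S
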